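/- **Theorem (Iteration complexity).** Let $G=(V,E)$ be a finite connected undirected graph with degree vector $d$, let $p\ge 2$ and $1/p+1/q=1$, and let $\Delta:V\to\mathbb R_{\ge 0}$ have total mass $|\Delta|=\sum_i\Delta(i)$ with $0<|\Delta|<\mathrm{vol}(G)=\sum_i\deg(i)$. Put $$F(x)=\tfrac1q\sum_{\{i,j\}\in E}|x(i)-x(j)|^q-x^T(\Delta-d),\qquad F_\mu(x)=\tfrac1q\sum_{\{i,j\}\in E}\big((x(i)-x(j))^2+\mu^2\big)^{q/2}-x^T(\Delta-d),$$ for $\mu>0$. Then $F$ attains its minimum $F^*$ over $x\ge0$, and $F_\mu$ has a unique minimizer $x_\mu^*$ over $x\ge 0$, with value $F_\mu^*$. Let $x_0=0$ and, for $k\ge 0$, let $S_k=\{i\in V:\nabla_iF_\mu(x_k)<0\}$; if $S_k=\emptyset$ then $x_{k+1}=x_k$, and otherwise $x_{k+1}=x_k-\frac{\mu^{2-q}}{\deg(i_k)}\nabla_{i_k}F_\mu(x_k)\,e_{i_k}$ with $i_k\in S_k$ picked uniformly at random. Let $$U=\{x\in\mathbb R^V:\ \mathrm{supp}(x)\subseteq\mathrm{supp}(x_\mu^*),\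 (x(i)-x(j))^2+\mu^2\le|\Delta|^{2p-2}\ \text{for all } \{i,j\}\in E\},$$ and call $\gamma>0$ a *strong convexity parameter* if $F_\mu(y)\ge F_\mu(x)+\nabla F_\mu(x)^T(y-x)+\frac\gamma2\|y-x\|_2^2$ for all $x,y\in U$. Let $\bar d=\max_{i\in\mathrm{supp}(x_\mu^*)}\deg(i)$ and $L_\mu=\max_{i\in\mathrm{supp}(x_\mu^*)}\deg(i)\mu^{q-2}$ (both $0$ if $x_\mu^*=0$). If $\mu\le1$, there is a strong convexity parameter $\gamma>\frac{1}{(p-1)|\Delta|^p}$. Moreover, there are absolute constants $C,c_0>0$ and, for each $c\in(0,c_0]$, a constant $C'>0$ depending only on $c$, such that for all $0<\varepsilon\le\varepsilon_0$, where $\varepsilon_0\in(0,1)$ depends only on $c$, $p$ and $|\Delta|$, and for every strong convexity parameter $\gamma$: 1. if $\mu\le1$, then $\mathbb E[F_\mu(x_K)]-F_\mu^*\le\varepsilon$ for every integer $K\ge C\,\frac{|\Delta|L_\mu}{\gamma}\log\frac1\varepsilon$; 2. if $c\,(\varepsilon/|\Delta|)^{1/q}\le\mu\le c_0\,(\varepsilon/|\Delta|)^{1/q}$,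 then $\mathbb E[F(x_{K'})]-F^*\le\varepsilon$ for every integer $K'\ge C'\,\frac{|\Delta|\bar d}{\gamma}\big(\frac{|\Delta|}{\varepsilon}\big)^{2/q-1}\log\frac1\varepsilon$. -/

import Mathlib

open MeasureTheory

universe u

namespace FlowDiffusion

section Definitions

variable {V : Type u} [Fintype V] [DecidableEq V]

/-- The nonnegative orthant, the feasible set of the regularized dual problems. -/
def orthant (V : Type u) : Set (EuclideanSpace ℝ V) := {x | ∀ i, 0 ≤ x i}

/-- `x` is an optimal solution of `min_{x ≥ 0} f(x)`. -/
def IsOptimal (f : EuclideanSpace ℝ V → ℝ) (x : EuclideanSpace ℝ V) : Prop :=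
  x ∈ orthant V ∧ ∀ y ∈ orthant V, f x ≤ f y

/-- The length `|x(i) - x(j)|` of the edge `{i, j}`, that is, the absolute value of the
corresponding entry of `B x`, which does not depend on the orientation chosen for `B`. -/
noncomputable def edgeLength (x : EuclideanSpace ℝ V) : Sym2 V → ℝ :=
  Sym2.lift ⟨fun i j => |x i - x j|, fun i j => abs_sub_comm (x i) (x j)⟩

/-- The total mass `|Δ|`. -/
def mass (Δ : V → ℝ) : ℝ := ∑ i, Δ i

/-- The volume of the graph, the sum of all degrees. -/
def vol (G : SimpleGraph V) [DecidableRel G.Adj] : ℝ := ∑ i, (G.degree i : ℝ)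

/-- The `q`-norm regularized dual objective
`F(x) = (1/q) ‖B x‖_q^q - xᵀ(Δ - d)`. -/
noncomputable def dualObj (G : SimpleGraph V) [DecidableRel G.Adj] (Δ : V → ℝ) (q : ℝ)
    (x : EuclideanSpace ℝ V) : ℝ :=
  1 / q * ∑ e ∈ G.edgeFinset, edgeLength x e ^ q - ∑ i, x i * (Δ i - G.degree i)

/-- The globally smoothed objective
`F_μ(x) = (1/q) ∑_{(i,j) ∈ E} ((x(i) - x(j))² + μ²)^{q/2} - xᵀ(Δ - d)`. -/
noncomputable def smoothObj (G : SimpleGraph V) [DecidableRel G.Adj] (Δ : V → ℝ) (q μ : ℝ)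
    (x : EuclideanSpace ℝ V) : ℝ :=
  1 / q * ∑ e ∈ G.edgeFinset, (edgeLength x e ^ 2 + μ ^ 2) ^ (q / 2)
    - ∑ i, x i * (Δ i - G.degree i)

/-- The set `S(x)` of the nodes `i` with `∇_i F_μ(x) < 0`. -/
noncomputable def activeSet (G : SimpleGraph V) [DecidableRel G.Adj] (Δ : V → ℝ) (q μ : ℝ)
    (x : EuclideanSpace ℝ V) : Finset V :=
  Finset.univ.filter fun i => gradient (smoothObj G Δ q μ) x i < 0

/-- The coordinate update `x - (μ^{2-q} / deg(i)) ∇_i F_μ(x) e_i`. -/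
noncomputable def coordStep (G : SimpleGraph V) [DecidableRel G.Adj] (Δ : V → ℝ) (q μ : ℝ)
    (x : EuclideanSpace ℝ V) (i : V) : EuclideanSpace ℝ V :=
  x - (μ ^ (2 - q) / (G.degree i : ℝ) * gradient (smoothObj G Δ q μ) x i) •
    EuclideanSpace.single i (1 : ℝ)

/-- One iteration of the algorithm from `x`: if `S(x)` is empty the algorithm has returned `x`
and the iterate stays there, otherwise a node of `S(x)` is picked uniformly at random and
updated. -/
noncomputable def stepLaw (G : SimpleGraph V) [DecidableRel G.Adj] (Δ : V → ℝ) (q μ : ℝ)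
    (x : EuclideanSpace ℝ V) : PMF (EuclideanSpace ℝ V) :=
  if h : (activeSet G Δ q μ x).Nonempty then
    (PMF.uniformOfFinset (activeSet G Δ q μ x) h).map (coordStep G Δ q μ x)
  else PMF.pure x

/-- The law of the `k`-th iterate `x_k` of randomized coordinate descent started at `x_0 = 0`. -/
noncomputable def iterateLaw (G : SimpleGraph V) [DecidableRel G.Adj] (Δ : V → ℝ) (q μ : ℝ) :
    ℕ → PMF (EuclideanSpace ℝ V)
  | 0 => PMF.pure 0
  | k + 1 => (iterateLaw G Δ q μ k).bind (stepLaw G Δ q μ)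

/-- The expectation `𝔼[f(x_k)]`. -/
noncomputable def expectedValue (G : SimpleGraph V) [DecidableRel G.Adj] (Δ : V → ℝ) (q μ : ℝ)
    (f : EuclideanSpace ℝ V → ℝ) (k : ℕ) : ℝ :=
  ∫ x, f x ∂(iterateLaw G Δ q μ k).toMeasure

/-- The set `U(x⋆)` of the `x` with `supp(x) ⊆ supp(x⋆)` and
`(x(i) - x(j))² + μ² ≤ |Δ|^{2p-2}` on all edges. -/
def localSet (G : SimpleGraph V) (Δ : V → ℝ) (p μ : ℝ) (xs : EuclideanSpace ℝ V) :
    Set (EuclideanSpace ℝ V) :=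
  {x | (∀ i, x i ≠ 0 → xs i ≠ 0) ∧
    ∀ i j, G.Adj i j → (x i - x j) ^ 2 + μ ^ 2 ≤ mass Δ ^ (2 * p - 2)}

/-- `γ` is a strong convexity parameter of the differentiable function `f` on the set `U`. -/
def IsStrongConvexityParam (f : EuclideanSpace ℝ V → ℝ) (U : Set (EuclideanSpace ℝ V)) (γ : ℝ) :
    Prop :=
  ∀ x ∈ U, ∀ y ∈ U, f x + inner ℝ (gradient f x) (y - x) + γ / 2 * ‖y - x‖ ^ 2 ≤ f y

/-- `L_μ`, the maximum of `L_i = deg(i) μ^{q-2}` over `i ∈ supp(x⋆)` (`0` if the support is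
empty). -/
noncomputable def maxLip (G : SimpleGraph V) [DecidableRel G.Adj] (q μ : ℝ)
    (xs : EuclideanSpace ℝ V) : ℝ :=
  sSup ((fun i => (G.degree i : ℝ) * μ ^ (q - 2)) '' {i | xs i ≠ 0})

/-- The maximum of `deg(i)` over `i ∈ supp(x⋆)` (`0` if the support is empty). -/
noncomputable def maxDeg (G : SimpleGraph V) [DecidableRel G.Adj]
    (xs : EuclideanSpace ℝ V) : ℝ :=
  sSup ((fun i => (G.degree i : ℝ)) '' {i | xs i ≠ 0})

end Definitions

end FlowDiffusion

set_option linter.unusedSectionVars false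

/-! The proof rests on an invariant, the set `settled`: feasible points whose gradient is
nonpositive at every positive coordinate. The origin is settled, a coordinate step of length 1/L_i
never overshoots zero gradient, and raising one node only lowers the gradient at the others; hence
every iterate is settled (`coordStep_mem_settled`). Minimizers are settled too, and have nonnegative
gradient everywhere.

Flow conservation makes settled points small. Summing the gradient over a set A of positive nodes
cancels the flow inside A, so the flow leaving A plus vol(A) is at most |Δ| (`cut_add_vol_le`). With
A the support, the support has volume at most |Δ|; with A a superlevel set, each edge carries flow
at most |Δ| - 1, which is the edge constraint of U. A comparison principle (`settled_le`) puts
settled points below every minimizer. Thus the iterates stay in U and increase towards the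
minimizer, which is unique.

On U each edge potential has curvature at least (q-1)|Δ|^(2-p), and a Poincaré inequality over a
support of volume less than |Δ| turns this into a strong convexity parameter exceeding
1/((p-1)|Δ|^p). Since the minimizer lies above the iterate, strong convexity bounds the gap by the
squared negative gradient entries alone, and there are at most |Δ| of these. A uniformly random one
therefore contracts the expected gap by 1 - γ/(|Δ|L_μ) (`sum_activeSet_gap_le`). The initial gap is
at most |Δ|^(p+1), which the choice of ε₀ absorbs into the logarithm.

For F itself, smoothing adds the constant μ^q/q on every edge where x does not vary. After this
constant is subtracted, only the at most |Δ| varying edges contribute an error, so F and F_μ gaps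
differ by at most |Δ|μ^q, independently of the size of the graph. -/

namespace FlowDiffusion

/-! ### The scalar edge potential: curvature bounds and flow bounds. -/

section Scalar

/-- The smoothed potential `t ↦ (t² + μ²)^{q/2} / q` of an edge. -/
noncomputable def smoothPot (q μ t : ℝ) : ℝ := 1 / q * (t ^ 2 + μ ^ 2) ^ (q / 2)

/-- The flow `t ↦ t (t² + μ²)^{q/2-1}`, the derivative of the smoothed potential. -/
noncomputable def smoothFlow (q μ t : ℝ) : ℝ := t * (t ^ 2 + μ ^ 2) ^ (q / 2 - 1)

variable {q μ : ℝ}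

lemma sq_add_sq_pos_of_right (hμ : 0 < μ) (t : ℝ) : 0 < t ^ 2 + μ ^ 2 := by positivity

lemma smoothFlow_neg (t : ℝ) : smoothFlow q μ (-t) = -smoothFlow q μ t := by simp [smoothFlow]

lemma smoothFlow_zero : smoothFlow q μ 0 = 0 := by simp [smoothFlow]

lemma hasDerivAt_sq_add_sq (t : ℝ) : HasDerivAt (fun t : ℝ => t ^ 2 + μ ^ 2) (2 * t) t := by
  simpa using (hasDerivAt_pow 2 t).add_const (μ ^ 2)

lemma hasDerivAt_smoothPot (hq : 0 < q) (hμ : 0 < μ) (t : ℝ) :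
    HasDerivAt (smoothPot q μ) (smoothFlow q μ t) t := by
  have h := ((hasDerivAt_sq_add_sq (μ := μ) t).rpow_const (p := q / 2)
    (Or.inl (sq_add_sq_pos_of_right hμ t).ne')).const_mul (1 / q)
  refine h.congr_deriv ?_
  unfold smoothFlow
  field_simp

lemma hasDerivAt_smoothFlow (hμ : 0 < μ) (t : ℝ) :
    HasDerivAt (smoothFlow q μ)
      ((t ^ 2 + μ ^ 2) ^ (q / 2 - 1) - (2 - q) * (t ^ 2 * (t ^ 2 + μ ^ 2) ^ (q / 2 - 1 - 1))) t := by
  have h := (hasDerivAt_id t).mul ((hasDerivAt_sq_add_sq (μ := μ) t).rpow_const (p := q / 2 - 1)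
    (Or.inl (sq_add_sq_pos_of_right hμ t).ne'))
  refine h.congr_deriv ?_
  simp only [id]
  ring

lemma deriv_smoothFlow_ge (hq : q ≤ 2) (hμ : 0 < μ) (t : ℝ) :
    (q - 1) * (t ^ 2 + μ ^ 2) ^ (q / 2 - 1) ≤
      (t ^ 2 + μ ^ 2) ^ (q / 2 - 1) - (2 - q) * (t ^ 2 * (t ^ 2 + μ ^ 2) ^ (q / 2 - 1 - 1)) := by
  have hs := sq_add_sq_pos_of_right hμ t
  have h1 : t ^ 2 * (t ^ 2 + μ ^ 2) ^ (q / 2 - 1 - 1) ≤ (t ^ 2 + μ ^ 2) ^ (q / 2 - 1) := by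
    rw [Real.rpow_sub_one hs.ne' (q / 2 - 1), mul_div_assoc', div_le_iff₀ hs, mul_comm]
    exact mul_le_mul_of_nonneg_left (by nlinarith) (by positivity)
  nlinarith

lemma rpow_smooth_le (hq : q ≤ 2) (hμ : 0 < μ) (t : ℝ) :
    (t ^ 2 + μ ^ 2) ^ (q / 2 - 1) ≤ μ ^ (q - 2) := by
  have h : μ ^ (q - 2) = (μ ^ 2) ^ (q / 2 - 1) := by
    rw [← Real.rpow_natCast, ← Real.rpow_mul hμ.le]
    congr 1
    push_cast
    ring
  rw [h]
  exact Real.rpow_le_rpow_of_nonpos (by positivity) (by nlinarith) (by linarith)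

lemma deriv_smoothFlow_le (hq : q ≤ 2) (hμ : 0 < μ) (t : ℝ) :
    (t ^ 2 + μ ^ 2) ^ (q / 2 - 1) - (2 - q) * (t ^ 2 * (t ^ 2 + μ ^ 2) ^ (q / 2 - 1 - 1)) ≤
      μ ^ (q - 2) := by
  have hs := sq_add_sq_pos_of_right hμ t
  have h1 : 0 ≤ (2 - q) * (t ^ 2 * (t ^ 2 + μ ^ 2) ^ (q / 2 - 1 - 1)) :=
    mul_nonneg (by linarith) (by positivity)
  linarith [rpow_smooth_le hq hμ t]

lemma strictMono_smoothFlow (hq1 : 1 < q) (hq : q ≤ 2) (hμ : 0 < μ) :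
    StrictMono (smoothFlow q μ) := by
  refine strictMono_of_deriv_pos fun t => ?_
  rw [(hasDerivAt_smoothFlow hμ t).deriv]
  refine lt_of_lt_of_le ?_ (deriv_smoothFlow_ge hq hμ t)
  have := sq_add_sq_pos_of_right hμ t
  have : 0 < q - 1 := by linarith
  positivity

lemma smoothFlow_nonneg {t : ℝ} (ht : 0 ≤ t) : 0 ≤ smoothFlow q μ t := by
  unfold smoothFlow; positivity

lemma smoothFlow_pos (hμ : 0 < μ) {t : ℝ} (ht : 0 < t) : 0 < smoothFlow q μ t := by
  unfold smoothFlow; positivity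

/-- A function whose derivative is monotone on an interval lies above its tangents there. -/
lemma tangent_le_of_monotoneOn {f f' : ℝ → ℝ} (hf : ∀ t, HasDerivAt f (f' t) t) {s : Set ℝ}
    (hs : s.OrdConnected) (hm : MonotoneOn f' s) {a b : ℝ} (ha : a ∈ s) (hb : b ∈ s) :
    f a + f' a * (b - a) ≤ f b := by
  have hc : Continuous f := continuous_iff_continuousAt.2 fun t => (hf t).continuousAt
  rcases lt_trichotomy a b with h | h | h
  · obtain ⟨ξ, hξ, he⟩ := exists_hasDerivAt_eq_slope f f' h hc.continuousOn fun t _ => hf t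
    have h1 := hm ha (hs.out ha hb ⟨hξ.1.le, hξ.2.le⟩) hξ.1.le
    rw [eq_div_iff (by linarith)] at he
    nlinarith
  · subst h; simp
  · obtain ⟨ξ, hξ, he⟩ := exists_hasDerivAt_eq_slope f f' h hc.continuousOn fun t _ => hf t
    have h1 := hm (hs.out hb ha ⟨hξ.1.le, hξ.2.le⟩) ha hξ.2.le
    rw [eq_div_iff (by linarith)] at he
    nlinarith

lemma monotoneOn_of_hasDerivAt {f f' : ℝ → ℝ} (hf : ∀ t, HasDerivAt f (f' t) t) {s : Set ℝ}
    (hs : Convex ℝ s) (hn : ∀ t ∈ s, 0 ≤ f' t) : MonotoneOn f s := by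
  refine monotoneOn_of_deriv_nonneg hs
    (continuous_iff_continuousAt.2 fun t => (hf t).continuousAt).continuousOn
    (fun t _ => (hf t).differentiableAt.differentiableWithinAt) fun t ht => ?_
  rw [(hf t).deriv]
  exact hn t (interior_subset ht)

lemma hasDerivAt_const_mul_sq (σ t : ℝ) : HasDerivAt (fun t : ℝ => σ / 2 * t ^ 2) (σ * t) t := by
  refine ((hasDerivAt_pow 2 t).const_mul (σ / 2)).congr_deriv ?_
  norm_num
  ring

/-- The constraint cuts out an interval around 0 on which the flow has derivative at least σ.
Subtracting σt²/2 from the potential leaves a monotone derivative there, so the tangent inequality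
applies to the difference. -/
lemma smoothPot_quadratic_lower (hq1 : 1 < q) (hq : q ≤ 2) (hμ : 0 < μ) {R : ℝ} {a b : ℝ}
    (ha : a ^ 2 + μ ^ 2 ≤ R) (hb : b ^ 2 + μ ^ 2 ≤ R) :
    smoothPot q μ a + smoothFlow q μ a * (b - a) + (q - 1) * R ^ (q / 2 - 1) / 2 * (b - a) ^ 2 ≤
      smoothPot q μ b := by
  set σ := (q - 1) * R ^ (q / 2 - 1) with hσ
  set s : Set ℝ := Set.Icc (-√(R - μ ^ 2)) √(R - μ ^ 2)
  have hmem : ∀ t : ℝ, t ^ 2 + μ ^ 2 ≤ R → t ∈ s := fun t ht =>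
    abs_le.1 (Real.abs_le_sqrt (by linarith))
  have hmem' : ∀ t ∈ s, t ^ 2 + μ ^ 2 ≤ R := fun t ht => by
    have h0 : 0 ≤ R - μ ^ 2 := by nlinarith
    have := sq_le_sq' ht.1 ht.2
    rw [Real.sq_sqrt h0] at this
    linarith
  have hm : MonotoneOn (fun t => smoothFlow q μ t - σ * t) s := by
    refine monotoneOn_of_hasDerivAt
      (fun t => (hasDerivAt_smoothFlow hμ t).sub ((hasDerivAt_id t).const_mul σ))
      (convex_Icc _ _) fun t ht => ?_
    have h1 := deriv_smoothFlow_ge hq hμ t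
    have h2 : R ^ (q / 2 - 1) ≤ (t ^ 2 + μ ^ 2) ^ (q / 2 - 1) :=
      Real.rpow_le_rpow_of_nonpos (sq_add_sq_pos_of_right hμ t) (hmem' t ht) (by linarith)
    have h3 : (q - 1) * R ^ (q / 2 - 1) ≤ (q - 1) * (t ^ 2 + μ ^ 2) ^ (q / 2 - 1) :=
      mul_le_mul_of_nonneg_left h2 (by linarith)
    rw [hσ]
    linarith
  have := tangent_le_of_monotoneOn (f := fun t => smoothPot q μ t - σ / 2 * t ^ 2)
    (fun t => (hasDerivAt_smoothPot (by linarith) hμ t).sub (hasDerivAt_const_mul_sq σ t))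
    Set.ordConnected_Icc hm (hmem a ha) (hmem b hb)
  nlinarith

lemma smoothPot_tangent_le (hq1 : 1 < q) (hq : q ≤ 2) (hμ : 0 < μ) (a b : ℝ) :
    smoothPot q μ a + smoothFlow q μ a * (b - a) ≤ smoothPot q μ b :=
  tangent_le_of_monotoneOn (hasDerivAt_smoothPot (by linarith) hμ) Set.ordConnected_univ
    ((strictMono_smoothFlow hq1 hq hμ).monotone.monotoneOn _) (Set.mem_univ a) (Set.mem_univ b)

lemma monotone_lipschitz_sub_smoothFlow (hq : q ≤ 2) (hμ : 0 < μ) :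
    Monotone fun t => μ ^ (q - 2) * t - smoothFlow q μ t := by
  rw [← monotoneOn_univ]
  refine monotoneOn_of_hasDerivAt
    (fun t => ((hasDerivAt_id t).const_mul (μ ^ (q - 2))).sub (hasDerivAt_smoothFlow hμ t))
    convex_univ fun t _ => ?_
  have := deriv_smoothFlow_le hq hμ t
  linarith

lemma smoothPot_quadratic_upper (hq1 : 1 < q) (hq : q ≤ 2) (hμ : 0 < μ) (a b : ℝ) :
    smoothPot q μ b ≤
      smoothPot q μ a + smoothFlow q μ a * (b - a) + μ ^ (q - 2) / 2 * (b - a) ^ 2 := by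
  have := tangent_le_of_monotoneOn (f := fun t => μ ^ (q - 2) / 2 * t ^ 2 - smoothPot q μ t)
    (fun t => (hasDerivAt_const_mul_sq (μ ^ (q - 2)) t).sub
      (hasDerivAt_smoothPot (by linarith) hμ t)) Set.ordConnected_univ
    ((monotone_lipschitz_sub_smoothFlow hq hμ).monotoneOn _) (Set.mem_univ a) (Set.mem_univ b)
  nlinarith

/-- The one-sided Lipschitz bound that prevents a coordinate step from overshooting. -/
lemma smoothFlow_add_le (hq : q ≤ 2) (hμ : 0 < μ) (t : ℝ) {s : ℝ} (hs : 0 ≤ s) :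
    smoothFlow q μ (t + s) ≤ smoothFlow q μ t + μ ^ (q - 2) * s := by
  have := monotone_lipschitz_sub_smoothFlow hq hμ (show t ≤ t + s by linarith)
  simp only at this
  linarith

/-- A bound on the flow of an edge bounds its smoothed length. -/
lemma sq_add_sq_le_of_smoothFlow_le (hq1 : 1 < q) (hq : q ≤ 2) (hμ : 0 < μ) (hμ1 : μ ≤ 1)
    {t m : ℝ} (ht : 0 ≤ t) (hm : smoothFlow q μ t ≤ m - 1) {p : ℝ} (hpq : (p - 1) * (q - 1) = 1) :
    t ^ 2 + μ ^ 2 ≤ m ^ (2 * p - 2) := by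
  have hs := sq_add_sq_pos_of_right hμ t
  set w := √(t ^ 2 + μ ^ 2) with hw
  have hw0 : 0 < w := Real.sqrt_pos.2 hs
  have hww : t ^ 2 + μ ^ 2 = w ^ 2 := (Real.sq_sqrt hs.le).symm
  have hwt : w ≤ t + μ := by
    rw [hw]
    exact Real.sqrt_le_iff.2 ⟨by positivity, by nlinarith⟩
  have hpow : (t ^ 2 + μ ^ 2) ^ (q / 2 - 1) = w ^ (q - 2) := by
    rw [hww, ← Real.rpow_natCast, ← Real.rpow_mul hw0.le]
    congr 1
    push_cast
    ring
  -- Splitting w ≤ t + μ gives w^(q-1) ≤ t w^(q-2) + μ w^(q-2). The first term is the flow, at most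
  -- m - 1; the second is the cost of smoothing and fits in the remaining 1 because μ ≤ 1.
  have h1 : μ * w ^ (q - 2) ≤ 1 := by
    have h2 := rpow_smooth_le hq hμ t
    rw [hpow] at h2
    calc μ * w ^ (q - 2) ≤ μ * μ ^ (q - 2) := mul_le_mul_of_nonneg_left h2 hμ.le
      _ = μ ^ (q - 1) := by
        rw [← Real.rpow_one_add' hμ.le (by linarith)]; congr 1; ring
      _ ≤ 1 := Real.rpow_le_one hμ.le hμ1 (by linarith)
  have h3 : w ^ (q - 1) ≤ m := by
    have h4 : w ^ (q - 1) = w * w ^ (q - 2) := by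
      rw [← Real.rpow_one_add' hw0.le (by linarith)]; congr 1; ring
    have h5 : w * w ^ (q - 2) ≤ (t + μ) * w ^ (q - 2) :=
      mul_le_mul_of_nonneg_right hwt (by positivity)
    unfold smoothFlow at hm
    rw [hpow] at hm
    rw [h4]
    linarith
  have hp : 0 < p - 1 := by nlinarith
  have h6 : w = (w ^ (q - 1)) ^ (p - 1) := by
    rw [← Real.rpow_mul hw0.le, mul_comm, hpq, Real.rpow_one]
  have h7 : w ≤ m ^ (p - 1) := by
    rw [h6]
    exact Real.rpow_le_rpow (by positivity) h3 hp.le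
  have hm0 : 0 ≤ m := le_trans (by positivity) h3
  have h8 : m ^ (2 * p - 2) = (m ^ (p - 1)) ^ 2 := by
    rw [← Real.rpow_natCast, ← Real.rpow_mul hm0]
    congr 1
    push_cast
    ring
  rw [hww, h8]
  exact pow_le_pow_left₀ hw0.le h7 2

end Scalar

end FlowDiffusion

namespace FlowDiffusion

/-! ### Calculus of the smoothed objective on the graph. -/

section Graph

variable {V : Type u} [Fintype V] [DecidableEq V] (G : SimpleGraph V) [DecidableRel G.Adj]

/-- The `0`-`1` adjacency weights of a graph. -/
def wt (i j : V) : ℝ := if G.Adj i j then 1 else 0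

lemma wt_comm (i j : V) : wt G i j = wt G j i := by simp [wt, G.adj_comm]

lemma wt_nonneg (i j : V) : 0 ≤ wt G i j := by unfold wt; split_ifs <;> norm_num

lemma wt_of_adj {i j : V} (h : G.Adj i j) : wt G i j = 1 := by simp [wt, h]

lemma wt_self (i : V) : wt G i i = 0 := by simp [wt]

lemma sum_wt (i : V) : ∑ j, wt G i j = G.degree i := by
  simp only [wt, Finset.sum_boole]
  rw [← G.card_neighborFinset_eq_degree, G.neighborFinset_eq_filter]

lemma sum_edgeFinset_eq (f : Sym2 V → ℝ) :
    ∑ e ∈ G.edgeFinset, f e = 1 / 2 * ∑ i, ∑ j, wt G i j * f s(i, j) := by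
  have h1 : ∑ i, ∑ j, wt G i j * f s(i, j) =
      ∑ x ∈ (Finset.univ : Finset (V × V)) with G.Adj x.1 x.2, f s(x.1, x.2) := by
    rw [Finset.sum_filter, ← Finset.univ_product_univ, Finset.sum_product]
    simp [wt]
  rw [h1, ← Finset.sum_fiberwise_of_maps_to (t := G.edgeFinset) (g := fun x : V × V => s(x.1, x.2))
    (by simp)]
  rw [Finset.mul_sum]
  refine Finset.sum_congr rfl fun e he => ?_
  induction e using Sym2.ind with
  | _ a b =>
    have hab : G.Adj a b := by simpa using he
    have h2 : ((Finset.univ : Finset (V × V)).filter (fun x => G.Adj x.1 x.2)).filter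
        (fun x => s(x.1, x.2) = s(a, b)) = {(a, b), (b, a)} := by
      ext ⟨x, y⟩
      simp only [Finset.mem_filter, Finset.mem_univ, true_and, Sym2.eq_iff, Finset.mem_insert,
        Finset.mem_singleton, Prod.mk.injEq]
      constructor
      · exact fun h => h.2
      · rintro (⟨rfl, rfl⟩ | ⟨rfl, rfl⟩)
        · exact ⟨hab, Or.inl ⟨rfl, rfl⟩⟩
        · exact ⟨hab.symm, Or.inr ⟨rfl, rfl⟩⟩
    rw [h2, Finset.sum_pair (by simp [hab.ne]), Sym2.eq_swap (a := b)]
    ring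

lemma edgeLength_mk (x : EuclideanSpace ℝ V) (i j : V) : edgeLength x s(i, j) = |x i - x j| := rfl

lemma edgeLength_nonneg (x : EuclideanSpace ℝ V) (e : Sym2 V) : 0 ≤ edgeLength x e := by
  induction e using Sym2.ind with
  | _ a b => exact abs_nonneg _

lemma sum_antisymm {c : V → V → ℝ} (hc : ∀ i j, c j i = -c i j) (A : Finset V) :
    ∑ i ∈ A, ∑ j ∈ A, c i j = 0 := by
  have h : ∑ i ∈ A, ∑ j ∈ A, c i j = -∑ i ∈ A, ∑ j ∈ A, c i j := by
    conv_lhs => rw [Finset.sum_comm]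
    simp only [← Finset.sum_neg_distrib]
    exact Finset.sum_congr rfl fun i _ => Finset.sum_congr rfl fun j _ => hc i j
  linarith

/-- Flow conservation: contributions inside A cancel in pairs. -/
lemma sum_antisymm_eq_cut {c : V → V → ℝ} (hc : ∀ i j, c j i = -c i j) (A : Finset V) :
    ∑ i ∈ A, ∑ j, c i j = ∑ i ∈ A, ∑ j ∈ Aᶜ, c i j := by
  have h : ∀ i, ∑ j, c i j = ∑ j ∈ A, c i j + ∑ j ∈ Aᶜ, c i j := fun i =>
    (Finset.sum_add_sum_compl A _).symm
  simp only [h, Finset.sum_add_distrib, sum_antisymm hc A, zero_add]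

variable (Δ : V → ℝ) (q μ : ℝ)

lemma smoothObj_eq (x : EuclideanSpace ℝ V) :
    smoothObj G Δ q μ x = 1 / 2 * ∑ i, ∑ j, wt G i j * smoothPot q μ (x i - x j)
      - ∑ i, x i * (Δ i - G.degree i) := by
  rw [smoothObj, Finset.mul_sum,
    sum_edgeFinset_eq G (fun e => 1 / q * (edgeLength x e ^ 2 + μ ^ 2) ^ (q / 2))]
  simp only [edgeLength_mk, sq_abs, smoothPot]

/-- The partial derivatives of the smoothed objective. -/
noncomputable def dualGrad (x : EuclideanSpace ℝ V) (i : V) : ℝ :=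
  ∑ j, wt G i j * smoothFlow q μ (x i - x j) - (Δ i - G.degree i)

/-- Summation by parts, using that the flow is odd and the weights symmetric. -/
lemma half_sum_wt_smoothFlow_mul_sub (x h : V → ℝ) :
    1 / 2 * ∑ i, ∑ j, wt G i j * (smoothFlow q μ (x i - x j) * (h i - h j)) =
      ∑ i, (∑ j, wt G i j * smoothFlow q μ (x i - x j)) * h i := by
  have h1 : ∑ i, ∑ j, wt G i j * (smoothFlow q μ (x i - x j) * h j) =
      -∑ i, ∑ j, wt G i j * (smoothFlow q μ (x i - x j) * h i) := by
    rw [Finset.sum_comm]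
    simp only [← Finset.sum_neg_distrib]
    refine Finset.sum_congr rfl fun i _ => Finset.sum_congr rfl fun j _ => ?_
    rw [wt_comm G j i, ← neg_sub (x i), smoothFlow_neg]
    ring
  simp only [mul_sub, Finset.sum_sub_distrib, h1, Finset.sum_mul]
  simp only [mul_assoc]
  ring

lemma sum_dualGrad_mul (x : EuclideanSpace ℝ V) (h : V → ℝ) :
    ∑ i, dualGrad G Δ q μ x i * h i =
      1 / 2 * ∑ i, ∑ j, wt G i j * (smoothFlow q μ (x i - x j) * (h i - h j))
        - ∑ i, h i * (Δ i - G.degree i) := by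
  rw [half_sum_wt_smoothFlow_mul_sub G q μ x h, ← Finset.sum_sub_distrib]
  refine Finset.sum_congr rfl fun i _ => ?_
  rw [dualGrad]
  ring

variable {q μ}

lemma hasGradientAt_smoothObj (hq : 0 < q) (hμ : 0 < μ) (x : EuclideanSpace ℝ V) :
    HasGradientAt (smoothObj G Δ q μ) (WithLp.toLp 2 (dualGrad G Δ q μ x)) x := by
  rw [hasGradientAt_iff_hasFDerivAt]
  have hp : ∀ i, HasFDerivAt (fun y : EuclideanSpace ℝ V => y i)
      (EuclideanSpace.proj i : EuclideanSpace ℝ V →L[ℝ] ℝ) x := fun i =>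
    (EuclideanSpace.proj i : EuclideanSpace ℝ V →L[ℝ] ℝ).hasFDerivAt
  have h1 : HasFDerivAt (fun y : EuclideanSpace ℝ V =>
      1 / 2 * ∑ i, ∑ j, wt G i j * smoothPot q μ (y i - y j) - ∑ i, y i * (Δ i - G.degree i)) _ x :=
    ((HasFDerivAt.fun_sum fun i _ => HasFDerivAt.fun_sum fun j _ =>
      ((hasDerivAt_smoothPot hq hμ (x i - x j)).comp_hasFDerivAt x
        ((hp i).sub (hp j))).const_mul (wt G i j)).const_mul (1 / 2)).sub
    (HasFDerivAt.fun_sum fun i _ => (hp i).mul_const (Δ i - G.degree i))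
  have h2 : smoothObj G Δ q μ = fun y => 1 / 2 * ∑ i, ∑ j, wt G i j * smoothPot q μ (y i - y j)
      - ∑ i, y i * (Δ i - G.degree i) := funext fun y => smoothObj_eq G Δ q μ y
  rw [h2]
  refine h1.congr_fderiv ?_
  ext h
  have := sum_dualGrad_mul G Δ q μ x h
  simp only [sub_apply, smul_apply,
    sum_apply, smul_eq_mul,
    InnerProductSpace.toDual_apply_apply, PiLp.inner_apply, RCLike.inner_apply, conj_trivial]
  rw [show (∑ i, h.ofLp i * dualGrad G Δ q μ x i) = ∑ i, dualGrad G Δ q μ x i * h i from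
    Finset.sum_congr rfl fun i _ => mul_comm _ _, this]
  simp only [mul_comm (Δ _ - _)]
  rfl

lemma gradient_smoothObj_apply (hq : 0 < q) (hμ : 0 < μ) (x : EuclideanSpace ℝ V) (i : V) :
    gradient (smoothObj G Δ q μ) x i = dualGrad G Δ q μ x i := by
  rw [(hasGradientAt_smoothObj G Δ hq hμ x).gradient]

lemma inner_gradient_smoothObj (hq : 0 < q) (hμ : 0 < μ) (x h : EuclideanSpace ℝ V) :
    inner ℝ (gradient (smoothObj G Δ q μ) x) h = ∑ i, dualGrad G Δ q μ x i * h i := by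
  rw [(hasGradientAt_smoothObj G Δ hq hμ x).gradient]
  simp [PiLp.inner_apply, mul_comm]

lemma continuous_smoothObj (hq : 0 < q) (hμ : 0 < μ) : Continuous (smoothObj G Δ q μ) :=
  continuous_iff_continuousAt.2 fun x =>
    (hasGradientAt_iff_hasFDerivAt.1 (hasGradientAt_smoothObj G Δ hq hμ x)).continuousAt

/-- The linear term drops out of the Bregman divergence, which becomes a sum over edges. All
convexity and smoothness estimates thereby reduce to scalar ones. -/
lemma smoothObj_sub_tangent (x y : EuclideanSpace ℝ V) :
    smoothObj G Δ q μ y - smoothObj G Δ q μ x - ∑ i, dualGrad G Δ q μ x i * (y i - x i) =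
      1 / 2 * ∑ i, ∑ j, wt G i j * (smoothPot q μ (y i - y j) - smoothPot q μ (x i - x j)
        - smoothFlow q μ (x i - x j) * ((y i - y j) - (x i - x j))) := by
  rw [sum_dualGrad_mul, smoothObj_eq, smoothObj_eq]
  have h1 : ∀ i j, (y i - x i) - (y j - x j) = (y i - y j) - (x i - x j) := fun i j => by ring
  simp only [h1]
  simp only [mul_sub (wt G _ _), Finset.sum_sub_distrib, sub_mul]
  ring

/-- The Laplacian quadratic form of the graph. -/
noncomputable def dirichlet (h : V → ℝ) : ℝ := 1 / 2 * ∑ i, ∑ j, wt G i j * (h i - h j) ^ 2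

lemma smoothObj_upper (hq1 : 1 < q) (hq : q ≤ 2) (hμ : 0 < μ) (x y : EuclideanSpace ℝ V) :
    smoothObj G Δ q μ y ≤ smoothObj G Δ q μ x + ∑ i, dualGrad G Δ q μ x i * (y i - x i)
      + μ ^ (q - 2) / 2 * dirichlet G fun i => y i - x i := by
  have h := smoothObj_sub_tangent G Δ (q := q) (μ := μ) x y
  have h2 : ∑ i, ∑ j, wt G i j * (smoothPot q μ (y i - y j) - smoothPot q μ (x i - x j)
        - smoothFlow q μ (x i - x j) * ((y i - y j) - (x i - x j))) ≤
      ∑ i, ∑ j, μ ^ (q - 2) / 2 * (wt G i j * ((y i - x i) - (y j - x j)) ^ 2) := by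
    refine Finset.sum_le_sum fun i _ => Finset.sum_le_sum fun j _ => ?_
    have h3 := smoothPot_quadratic_upper hq1 hq hμ (x i - x j) (y i - y j)
    have h4 := wt_nonneg G i j
    rw [show ((y i - x i) - (y j - x j)) = (y i - y j) - (x i - x j) by ring]
    nlinarith
  simp only [← Finset.mul_sum] at h2
  rw [dirichlet]
  linarith

lemma smoothObj_lower (hq1 : 1 < q) (hq : q ≤ 2) (hμ : 0 < μ) {R : ℝ} (x y : EuclideanSpace ℝ V)
    (hx : ∀ i j, G.Adj i j → (x i - x j) ^ 2 + μ ^ 2 ≤ R)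
    (hy : ∀ i j, G.Adj i j → (y i - y j) ^ 2 + μ ^ 2 ≤ R) :
    smoothObj G Δ q μ x + ∑ i, dualGrad G Δ q μ x i * (y i - x i)
      + (q - 1) * R ^ (q / 2 - 1) / 2 * dirichlet G (fun i => y i - x i) ≤
        smoothObj G Δ q μ y := by
  have h := smoothObj_sub_tangent G Δ (q := q) (μ := μ) x y
  have h2 : ∑ i, ∑ j, (q - 1) * R ^ (q / 2 - 1) / 2 *
        (wt G i j * ((y i - x i) - (y j - x j)) ^ 2) ≤
      ∑ i, ∑ j, wt G i j * (smoothPot q μ (y i - y j) - smoothPot q μ (x i - x j)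
        - smoothFlow q μ (x i - x j) * ((y i - y j) - (x i - x j))) := by
    refine Finset.sum_le_sum fun i _ => Finset.sum_le_sum fun j _ => ?_
    by_cases hij : G.Adj i j
    · have h3 := smoothPot_quadratic_lower hq1 hq hμ (hx i j hij) (hy i j hij)
      rw [show ((y i - x i) - (y j - x j)) = (y i - y j) - (x i - x j) by ring, wt_of_adj G hij]
      linarith
    · simp [wt, hij]
  simp only [← Finset.mul_sum] at h2
  rw [dirichlet]
  linarith

lemma smoothObj_tangent_le (hq1 : 1 < q) (hq : q ≤ 2) (hμ : 0 < μ) (x y : EuclideanSpace ℝ V) :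
    smoothObj G Δ q μ x + ∑ i, dualGrad G Δ q μ x i * (y i - x i) ≤ smoothObj G Δ q μ y := by
  have h := smoothObj_sub_tangent G Δ (q := q) (μ := μ) x y
  have h2 : 0 ≤ ∑ i, ∑ j, wt G i j * (smoothPot q μ (y i - y j) - smoothPot q μ (x i - x j)
        - smoothFlow q μ (x i - x j) * ((y i - y j) - (x i - x j))) := by
    refine Finset.sum_nonneg fun i _ => Finset.sum_nonneg fun j _ => ?_
    have h3 := smoothPot_tangent_le hq1 hq hμ (x i - x j) (y i - y j)
    exact mul_nonneg (wt_nonneg G i j) (by linarith)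
  linarith

lemma dirichlet_single (i : V) (s : ℝ) :
    dirichlet G (Pi.single i s) = G.degree i * s ^ 2 := by
  have h : ∀ k l, wt G k l * ((Pi.single i s : V → ℝ) k - (Pi.single i s : V → ℝ) l) ^ 2 =
      wt G k l * (if k = i then s ^ 2 else 0) + wt G k l * (if l = i then s ^ 2 else 0) := by
    intro k l
    by_cases hk : k = i <;> by_cases hl : l = i
    · subst hk; subst hl; simp [wt_self]
    · simp [hk, hl]
    · simp [hk, hl]
    · simp [hk, hl]
  simp only [dirichlet, h, Finset.sum_add_distrib]
  have h1 : ∑ k, ∑ l, wt G k l * (if k = i then s ^ 2 else 0) = G.degree i * s ^ 2 := by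
    simp only [← Finset.sum_mul, sum_wt]
    simp
  have h2 : ∑ k, ∑ l, wt G k l * (if l = i then s ^ 2 else 0) = G.degree i * s ^ 2 := by
    rw [Finset.sum_comm, ← h1]
    simp only [wt_comm G]
  rw [h1, h2]
  ring

/-- The effect on the objective of moving along a coordinate direction. -/
lemma smoothObj_add_single_le (hq1 : 1 < q) (hq : q ≤ 2) (hμ : 0 < μ) (x : EuclideanSpace ℝ V)
    (i : V) (s : ℝ) :
    smoothObj G Δ q μ (x + EuclideanSpace.single i s) ≤ smoothObj G Δ q μ x
      + dualGrad G Δ q μ x i * s + G.degree i * μ ^ (q - 2) / 2 * s ^ 2 := by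
  have h := smoothObj_upper G Δ hq1 hq hμ x (x + EuclideanSpace.single i s)
  have h1 : (fun k => (x + EuclideanSpace.single i s) k - x k) = (Pi.single i s : V → ℝ) := by
    ext k; simp [Pi.single_apply]
  have h2 : ∀ k, (x + EuclideanSpace.single i s) k - x k = (Pi.single i s : V → ℝ) k :=
    fun k => congrFun h1 k
  rw [h1, dirichlet_single] at h
  simp only [h2] at h
  have h3 : ∑ k, dualGrad G Δ q μ x k * (Pi.single i s : V → ℝ) k = dualGrad G Δ q μ x i * s := by
    rw [Finset.sum_eq_single i] <;> simp +contextual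
  rw [h3] at h
  linarith

end Graph

end FlowDiffusion

namespace FlowDiffusion

/-! ### Settled points: flow bounds, comparison, and invariance under steps. -/

section Settled

variable {V : Type u} [Fintype V] [DecidableEq V] (G : SimpleGraph V) [DecidableRel G.Adj]
  (Δ : V → ℝ) (q μ : ℝ)

/-- The feasible points at which no node of the support can profitably be lowered below its
optimal value: `∇_i F_μ(x) ≤ 0` wherever `x i > 0`. -/
def settled : Set (EuclideanSpace ℝ V) :=
  {x | x ∈ orthant V ∧ ∀ i, 0 < x i → dualGrad G Δ q μ x i ≤ 0}

/-- The support of `x` as a finite set. -/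
noncomputable def supp (x : EuclideanSpace ℝ V) : Finset V := Finset.univ.filter fun i => x i ≠ 0

lemma mem_supp {x : EuclideanSpace ℝ V} {i : V} : i ∈ supp x ↔ x i ≠ 0 := by simp [supp]

variable {G Δ q μ}

lemma exists_adj_boundary (hG : G.Connected) {A : Finset V} {u v : V} (hu : u ∈ A) (hv : v ∉ A) :
    ∃ i ∈ A, ∃ j, j ∉ A ∧ G.Adj i j := by
  obtain ⟨p⟩ := hG.preconnected u v
  obtain ⟨d, -, h1, h2⟩ := p.exists_boundary_dart (A : Set V) (by simpa using hu) (by simpa using hv)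
  exact ⟨d.fst, by simpa using h1, d.snd, by simpa using h2, d.adj⟩

lemma one_le_degree (hG : G.Connected) (hvol : 0 < vol G) (i : V) : (1 : ℝ) ≤ G.degree i := by
  obtain ⟨k, hk⟩ : ∃ k, 0 < G.degree k := by
    by_contra! h
    have : vol G ≤ 0 := Finset.sum_nonpos fun k _ => by exact_mod_cast h k
    linarith
  obtain ⟨l, hl⟩ := (G.degree_pos_iff_exists_adj k).1 hk
  have : Nontrivial V := ⟨k, l, hl.ne⟩
  exact_mod_cast hG.preconnected.degree_pos_of_nontrivial i

lemma sum_dualGrad (x : EuclideanSpace ℝ V) (A : Finset V) :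
    ∑ i ∈ A, dualGrad G Δ q μ x i =
      ∑ i ∈ A, ∑ j ∈ Aᶜ, wt G i j * smoothFlow q μ (x i - x j) - ∑ i ∈ A, Δ i
        + ∑ i ∈ A, (G.degree i : ℝ) := by
  have h := sum_antisymm_eq_cut (c := fun i j => wt G i j * smoothFlow q μ (x i - x j))
    (fun i j => by rw [wt_comm G j i, ← neg_sub (x i), smoothFlow_neg]; ring) A
  simp only [dualGrad, Finset.sum_sub_distrib, h]
  ring

/-- The flow out of a set of settled nodes together with the volume of the set is at most the
total mass. -/
lemma cut_add_vol_le (hΔ : ∀ i, 0 ≤ Δ i) {x : EuclideanSpace ℝ V} (hx : x ∈ settled G Δ q μ)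
    {A : Finset V} (hA : ∀ i ∈ A, 0 < x i) :
    ∑ i ∈ A, ∑ j ∈ Aᶜ, wt G i j * smoothFlow q μ (x i - x j) + ∑ i ∈ A, (G.degree i : ℝ) ≤
      mass Δ := by
  have h1 : ∑ i ∈ A, dualGrad G Δ q μ x i ≤ 0 := Finset.sum_nonpos fun i hi => hx.2 i (hA i hi)
  rw [sum_dualGrad] at h1
  have h2 : ∑ i ∈ A, Δ i ≤ mass Δ :=
    Finset.sum_le_sum_of_subset_of_nonneg (Finset.subset_univ _) fun i _ _ => hΔ i
  linarith

lemma pos_of_mem_supp {x : EuclideanSpace ℝ V} (hx : x ∈ orthant V) {i : V} (hi : i ∈ supp x) :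
    0 < x i := lt_of_le_of_ne (hx i) (mem_supp.1 hi).symm

lemma wt_smoothFlow_nonneg {x : EuclideanSpace ℝ V} {i j : V} (h : x j ≤ x i) :
    0 ≤ wt G i j * smoothFlow q μ (x i - x j) :=
  mul_nonneg (wt_nonneg G i j) (smoothFlow_nonneg (by linarith))

lemma vol_supp_le (hΔ : ∀ i, 0 ≤ Δ i) {x : EuclideanSpace ℝ V} (hx : x ∈ settled G Δ q μ) :
    ∑ i ∈ supp x, (G.degree i : ℝ) ≤ mass Δ := by
  have h := cut_add_vol_le hΔ hx fun i hi => pos_of_mem_supp hx.1 hi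
  have h1 : 0 ≤ ∑ i ∈ supp x, ∑ j ∈ (supp x)ᶜ, wt G i j * smoothFlow q μ (x i - x j) :=
    Finset.sum_nonneg fun i _ => Finset.sum_nonneg fun j hj => wt_smoothFlow_nonneg (by
      rw [Finset.mem_compl, mem_supp, not_not] at hj
      rw [hj]; exact hx.1 i)
  linarith

/-- A full support would have volume vol(G) > |Δ|. The resulting zero node anchors both the
comparison principle and the Poincaré inequality. -/
lemma exists_eq_zero (hΔ : ∀ i, 0 ≤ Δ i) (hM : mass Δ < vol G) {x : EuclideanSpace ℝ V}
    (hx : x ∈ settled G Δ q μ) : ∃ v, x v = 0 := by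
  by_contra! h
  have h1 := vol_supp_le hΔ hx
  have h2 : supp x = Finset.univ := by ext i; simp [mem_supp, h i]
  rw [h2] at h1
  exact absurd h1 (not_le.2 hM)

lemma single_le_cut {x : EuclideanSpace ℝ V} {A : Finset V}
    (hA : ∀ i ∈ A, ∀ j ∉ A, x j ≤ x i) {i j : V} (hi : i ∈ A) (hj : j ∉ A) (hij : G.Adj i j) :
    smoothFlow q μ (x i - x j) ≤
      ∑ i ∈ A, ∑ j ∈ Aᶜ, wt G i j * smoothFlow q μ (x i - x j) := by
  have h0 : ∀ k ∈ A, ∀ l ∈ Aᶜ, 0 ≤ wt G k l * smoothFlow q μ (x k - x l) := fun k hk l hl =>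
    wt_smoothFlow_nonneg (hA k hk l (Finset.mem_compl.1 hl))
  calc smoothFlow q μ (x i - x j) = wt G i j * smoothFlow q μ (x i - x j) := by
        rw [wt_of_adj G hij, one_mul]
    _ ≤ ∑ l ∈ Aᶜ, wt G i l * smoothFlow q μ (x i - x l) :=
        Finset.single_le_sum (f := fun l => wt G i l * smoothFlow q μ (x i - x l)) (h0 i hi)
          (Finset.mem_compl.2 hj)
    _ ≤ _ := Finset.single_le_sum
        (f := fun k => ∑ l ∈ Aᶜ, wt G k l * smoothFlow q μ (x k - x l))
        (fun k hk => Finset.sum_nonneg (h0 k hk)) hi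

/-- Some edge leaves the support by connectedness and carries positive flow, which makes the cut
bound strict. This is the source of the strict inequality for γ. -/
lemma vol_supp_lt (hG : G.Connected) (hΔ : ∀ i, 0 ≤ Δ i) (hM : mass Δ < vol G) (hμ : 0 < μ)
    {x : EuclideanSpace ℝ V} (hx : x ∈ settled G Δ q μ) {u : V} (hu : x u ≠ 0) :
    ∑ i ∈ supp x, (G.degree i : ℝ) < mass Δ := by
  obtain ⟨v, hv⟩ := exists_eq_zero hΔ hM hx
  obtain ⟨i, hi, j, hj, hij⟩ := exists_adj_boundary hG (mem_supp.2 hu) (A := supp x)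
    (by simpa [mem_supp] using hv)
  have hz : ∀ k ∉ supp x, x k = 0 := fun k hk => by simpa [mem_supp] using hk
  have h1 := single_le_cut (q := q) (μ := μ) (fun k hk l hl => by rw [hz l hl]; exact hx.1 k) hi hj hij
  have h2 : 0 < smoothFlow q μ (x i - x j) := smoothFlow_pos hμ (by
    rw [hz j hj, sub_zero]; exact pos_of_mem_supp hx.1 hi)
  have h3 := cut_add_vol_le hΔ hx fun i hi => pos_of_mem_supp hx.1 hi
  linarith

lemma smoothFlow_le_of_adj (hΔ : ∀ i, 0 ≤ Δ i) (hdeg : ∀ i, (1 : ℝ) ≤ G.degree i)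
    {x : EuclideanSpace ℝ V} (hx : x ∈ settled G Δ q μ) {i j : V} (hij : G.Adj i j)
    (hlt : x j < x i) : smoothFlow q μ (x i - x j) ≤ mass Δ - 1 := by
  -- The superlevel set at x i separates i from j and all flow across its boundary points outwards.
  -- It contains i, whose degree is at least 1, hence the bound |Δ| - 1.
  set A : Finset V := Finset.univ.filter fun k => x i ≤ x k with hA
  have hmem : ∀ k, k ∈ A ↔ x i ≤ x k := by simp [hA]
  have h1 := single_le_cut (q := q) (μ := μ) (A := A) (x := x)
    (fun k hk l hl => by rw [hmem] at hk hl; linarith) ((hmem i).2 le_rfl)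
    (by rw [hmem]; linarith) hij
  have h2 := cut_add_vol_le hΔ hx (A := A) fun k hk => by
    have := hx.1 j
    have := (hmem k).1 hk
    linarith
  have h3 : (G.degree i : ℝ) ≤ ∑ k ∈ A, (G.degree k : ℝ) :=
    Finset.single_le_sum (f := fun k => (G.degree k : ℝ)) (fun k _ => by positivity)
      ((hmem i).2 le_rfl)
  have h4 := hdeg i
  linarith

/-- Settled points satisfy the edge constraints of the local set. -/
lemma sq_add_sq_le_of_settled (hq1 : 1 < q) (hq : q ≤ 2) (hμ : 0 < μ) (hμ1 : μ ≤ 1)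
    {p : ℝ} (hpq : (p - 1) * (q - 1) = 1) (hΔ : ∀ i, 0 ≤ Δ i) (hdeg : ∀ i, (1 : ℝ) ≤ G.degree i)
    (h1M : 1 ≤ mass Δ) {x : EuclideanSpace ℝ V} (hx : x ∈ settled G Δ q μ) {i j : V}
    (hij : G.Adj i j) : (x i - x j) ^ 2 + μ ^ 2 ≤ mass Δ ^ (2 * p - 2) := by
  wlog h : x j ≤ x i generalizing i j
  · have := this hij.symm (not_le.1 h).le
    rwa [← neg_sub, neg_sq] at this
  refine sq_add_sq_le_of_smoothFlow_le hq1 hq hμ hμ1 (sub_nonneg.2 h) ?_ hpq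
  rcases h.lt_or_eq with h | h
  · exact smoothFlow_le_of_adj hΔ hdeg hx hij h
  · rw [h, sub_self, smoothFlow_zero]
    linarith

/-- Settled points lie below all feasible points with nonnegative gradient. -/
lemma settled_le (hG : G.Connected) (hq1 : 1 < q) (hq : q ≤ 2) (hμ : 0 < μ) (hΔ : ∀ i, 0 ≤ Δ i)
    (hM : mass Δ < vol G) {x y : EuclideanSpace ℝ V} (hx : x ∈ settled G Δ q μ)
    (hy : y ∈ orthant V) (hg : ∀ i, 0 ≤ dualGrad G Δ q μ y i) (i : V) : x i ≤ y i := by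
  by_contra! hi
  -- On A the gradient of x is nonpositive and that of y nonnegative, so x sends no more flow out of
  -- A than y does. But every difference across the boundary of A is strictly larger for x, and a
  -- boundary edge exists: a contradiction.
  set A : Finset V := Finset.univ.filter fun k => y k < x k with hA
  have hmem : ∀ k, k ∈ A ↔ y k < x k := by simp [hA]
  have hpos : ∀ k ∈ A, 0 < x k := fun k hk => (hy k).trans_lt ((hmem k).1 hk)
  obtain ⟨v, hv⟩ := exists_eq_zero hΔ hM hx
  have hvA : v ∉ A := by rw [hmem, hv]; exact not_lt.2 (hy v)
  obtain ⟨a, ha, b, hb, hab⟩ := exists_adj_boundary hG ((hmem i).2 hi) hvA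
  have h1 : ∑ i ∈ A, dualGrad G Δ q μ x i ≤ ∑ i ∈ A, dualGrad G Δ q μ y i :=
    Finset.sum_le_sum fun k hk => (hx.2 k (hpos k hk)).trans (hg k)
  rw [sum_dualGrad, sum_dualGrad] at h1
  have hmono := strictMono_smoothFlow hq1 hq hμ
  have hle : ∀ k ∈ A, ∀ l ∈ Aᶜ, wt G k l * smoothFlow q μ (y k - y l) ≤
      wt G k l * smoothFlow q μ (x k - x l) := fun k hk l hl => by
    rw [Finset.mem_compl, hmem, not_lt] at hl
    have := (hmem k).1 hk
    exact mul_le_mul_of_nonneg_left (hmono.monotone (by linarith)) (wt_nonneg G k l)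
  have h2 : ∑ k ∈ A, ∑ l ∈ Aᶜ, wt G k l * smoothFlow q μ (y k - y l) <
      ∑ k ∈ A, ∑ l ∈ Aᶜ, wt G k l * smoothFlow q μ (x k - x l) := by
    refine Finset.sum_lt_sum (fun k hk => Finset.sum_le_sum (hle k hk)) ⟨a, ha, ?_⟩
    refine Finset.sum_lt_sum (hle a ha) ⟨b, Finset.mem_compl.2 hb, ?_⟩
    rw [wt_of_adj G hab, one_mul, one_mul]
    rw [hmem, not_lt] at hb
    have := (hmem a).1 ha
    exact hmono (by linarith)
  linarith

lemma zero_mem_settled : (0 : EuclideanSpace ℝ V) ∈ settled G Δ q μ :=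
  ⟨fun i => by simp, fun i hi => by simp at hi⟩

/-- Raising a node with negative gradient by the coordinate step keeps a point settled. -/
lemma add_single_mem_settled (hq1 : 1 < q) (hq : q ≤ 2) (hμ : 0 < μ)
    {x : EuclideanSpace ℝ V} (hx : x ∈ settled G Δ q μ) {i : V} {s : ℝ} (hs : 0 ≤ s)
    (hi : dualGrad G Δ q μ x i + G.degree i * μ ^ (q - 2) * s ≤ 0) :
    x + EuclideanSpace.single i s ∈ settled G Δ q μ := by
  have hk : ∀ k ≠ i, (x + EuclideanSpace.single i s) k = x k := fun k hk => by simp [hk]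
  have hii : (x + EuclideanSpace.single i s) i = x i + s := by simp
  have hge : ∀ k, x k ≤ (x + EuclideanSpace.single i s) k := fun k => by
    by_cases h : k = i
    · subst h; rw [hii]; linarith
    · rw [hk k h]
  refine ⟨fun k => (hx.1 k).trans (hge k), fun k hkpos => ?_⟩
  by_cases h : k = i
  · subst h
    refine le_trans ?_ hi
    -- At the raised node each incident flow grows by at most μ^(q-2) s.
    have h1 : ∑ j, wt G k j * smoothFlow q μ
          ((x + EuclideanSpace.single k s) k - (x + EuclideanSpace.single k s) j) ≤
        ∑ j, (wt G k j * smoothFlow q μ (x k - x j) + wt G k j * (μ ^ (q - 2) * s)) := by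
      refine Finset.sum_le_sum fun j _ => ?_
      rw [← mul_add]
      refine mul_le_mul_of_nonneg_left (le_trans ?_ (smoothFlow_add_le hq hμ (x k - x j) hs))
        (wt_nonneg G k j)
      refine (strictMono_smoothFlow hq1 hq hμ).monotone ?_
      rw [hii]
      linarith [hge j]
    rw [Finset.sum_add_distrib, ← Finset.sum_mul, sum_wt] at h1
    simp only [dualGrad]
    linarith
  -- At any other node the differences x k - x j can only shrink, and the gradient with them.
  · rw [hk k h] at hkpos
    refine le_trans ?_ (hx.2 k hkpos)
    simp only [dualGrad]
    refine sub_le_sub_right (Finset.sum_le_sum fun j _ =>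
      mul_le_mul_of_nonneg_left ?_ (wt_nonneg G k j)) _
    refine (strictMono_smoothFlow hq1 hq hμ).monotone ?_
    rw [hk k h]
    linarith [hge j]

lemma dualGrad_nonneg_of_isOptimal (hq1 : 1 < q) (hq : q ≤ 2) (hμ : 0 < μ)
    (hdeg : ∀ i, (1 : ℝ) ≤ G.degree i) {x : EuclideanSpace ℝ V}
    (hx : IsOptimal (smoothObj G Δ q μ) x) (i : V) : 0 ≤ dualGrad G Δ q μ x i := by
  by_contra! hi
  set g := dualGrad G Δ q μ x i with hg
  set L := (G.degree i : ℝ) * μ ^ (q - 2) with hL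
  have hL0 : 0 < L := mul_pos (by linarith [hdeg i]) (Real.rpow_pos_of_pos hμ _)
  have hs : 0 < -g / L := div_pos (by linarith) hL0
  have h1 := hx.2 (x + EuclideanSpace.single i (-g / L)) fun k => by
    have := hx.1 k
    by_cases h : k = i
    · subst h; simp; linarith
    · simpa [h] using this
  have h2 := smoothObj_add_single_le G Δ hq1 hq hμ x i (-g / L)
  rw [← hg, ← hL] at h2
  have h3 : g * (-g / L) + L / 2 * (-g / L) ^ 2 = -(g ^ 2 / (2 * L)) := by field_simp; ring
  have h4 : 0 < g ^ 2 / (2 * L) := by have := hi.ne; positivity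
  linarith

lemma settled_of_isOptimal (hq1 : 1 < q) (hq : q ≤ 2) (hμ : 0 < μ)
    (hdeg : ∀ i, (1 : ℝ) ≤ G.degree i) {x : EuclideanSpace ℝ V}
    (hx : IsOptimal (smoothObj G Δ q μ) x) : x ∈ settled G Δ q μ := by
  refine ⟨hx.1, fun i hxi => ?_⟩
  by_contra! hi
  set g := dualGrad G Δ q μ x i with hg
  set L := (G.degree i : ℝ) * μ ^ (q - 2) with hL
  have hL0 : 0 < L := mul_pos (by linarith [hdeg i]) (Real.rpow_pos_of_pos hμ _)
  -- The decrease is capped by x i for feasibility and by g/L so that the quadratic term costs at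
  -- most half the linear gain.
  set s := min (x i) (g / L) with hs
  have hs0 : 0 < s := lt_min hxi (div_pos hi hL0)
  have hsL : L * s ≤ g := by
    have : s ≤ g / L := min_le_right _ _
    rw [le_div_iff₀ hL0] at this
    linarith
  have hsx : s ≤ x i := min_le_left _ _
  have h1 := hx.2 (x + EuclideanSpace.single i (-s)) fun k => by
    have := hx.1 k
    by_cases h : k = i
    · subst h; simpa using hsx
    · simpa [h] using this
  have h2 := smoothObj_add_single_le G Δ hq1 hq hμ x i (-s)
  rw [← hg, ← hL] at h2
  nlinarith [mul_pos hs0 hi]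

end Settled

/-! ### Varying edges and the Poincaré inequality. -/

section Edges

variable {V : Type u} [Fintype V] [DecidableEq V] {G : SimpleGraph V} [DecidableRel G.Adj]

/-- The number of edges on which `x` varies is at most the volume of any set containing the
support of `x`. -/
lemma card_edgeLength_ne_zero_le {x : EuclideanSpace ℝ V} {T : Finset V}
    (hT : ∀ i, x i ≠ 0 → i ∈ T) :
    ((G.edgeFinset.filter fun e => edgeLength x e ≠ 0).card : ℝ) ≤
      ∑ i ∈ T, (G.degree i : ℝ) := by
  have h1 : ((G.edgeFinset.filter fun e => edgeLength x e ≠ 0).card : ℝ) =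
      ∑ e ∈ G.edgeFinset, if edgeLength x e ≠ 0 then (1 : ℝ) else 0 := by
    rw [Finset.sum_boole]
  rw [h1, sum_edgeFinset_eq]
  have h2 : ∑ i, ∑ j, wt G i j * (if i ∈ T then (1 : ℝ) else 0) = ∑ i ∈ T, (G.degree i : ℝ) := by
    simp only [← Finset.sum_mul, sum_wt]
    simp
  have h3 : ∑ i, ∑ j, wt G i j * (if j ∈ T then (1 : ℝ) else 0) = ∑ i ∈ T, (G.degree i : ℝ) := by
    rw [Finset.sum_comm, ← h2]
    simp only [wt_comm G]
  have h4 : ∑ i, ∑ j, wt G i j * (if edgeLength x s(i, j) ≠ 0 then (1 : ℝ) else 0) ≤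
      ∑ i, ∑ j, (wt G i j * (if i ∈ T then (1 : ℝ) else 0)
        + wt G i j * (if j ∈ T then (1 : ℝ) else 0)) := by
    refine Finset.sum_le_sum fun i _ => Finset.sum_le_sum fun j _ => ?_
    rw [← mul_add]
    refine mul_le_mul_of_nonneg_left ?_ (wt_nonneg G i j)
    by_cases hi : i ∈ T
    · by_cases hj : j ∈ T <;> simp only [hi, hj, if_true, if_false] <;> split_ifs <;> norm_num
    · by_cases hj : j ∈ T
      · simp only [hi, hj, if_true, if_false]; split_ifs <;> norm_num
      · have h5 : x i = 0 := by by_contra h; exact hi (hT i h)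
        have h6 : x j = 0 := by by_contra h; exact hj (hT j h)
        simp only [edgeLength_mk, h5, h6, sub_self, abs_zero, ne_eq, not_true_eq_false, if_false]
        split_ifs <;> norm_num
  simp only [Finset.sum_add_distrib, h2, h3] at h4
  linarith

lemma abs_sub_le_sum_edgeLength (hG : G.Connected) (x : EuclideanSpace ℝ V) (u v : V) :
    |x u - x v| ≤ ∑ e ∈ G.edgeFinset, edgeLength x e := by
  have hw : ∀ {u v : V} (p : G.Walk u v), |x u - x v| ≤ (p.edges.map (edgeLength x)).sum := by
    intro u v p
    induction p with
    | nil => simp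
    | cons h p ih =>
      rw [SimpleGraph.Walk.edges_cons, List.map_cons, List.sum_cons, edgeLength_mk]
      exact (abs_sub_le _ _ _).trans (add_le_add le_rfl ih)
  obtain ⟨p, hp⟩ := (hG.preconnected u v).exists_isPath
  refine (hw p).trans ?_
  rw [← List.sum_toFinset _ hp.isTrail.edges_nodup]
  refine Finset.sum_le_sum_of_subset_of_nonneg (fun e he => ?_) fun e _ _ => edgeLength_nonneg x e
  rw [SimpleGraph.mem_edgeFinset]
  exact p.edges_subset_edgeSet (List.mem_toFinset.1 he)

lemma dirichlet_eq (x : EuclideanSpace ℝ V) :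
    dirichlet G x = ∑ e ∈ G.edgeFinset, edgeLength x e ^ 2 := by
  rw [sum_edgeFinset_eq]
  simp only [edgeLength_mk, sq_abs, dirichlet]

/-- A Poincaré inequality for functions supported in a proper subset of the nodes. -/
lemma norm_sq_le_dirichlet (hG : G.Connected) (hdeg : ∀ i, (1 : ℝ) ≤ G.degree i)
    {x : EuclideanSpace ℝ V} {T : Finset V} (hT : ∀ i, x i ≠ 0 → i ∈ T) {v : V} (hv : v ∉ T) :
    ‖x‖ ^ 2 ≤ (∑ i ∈ T, (G.degree i : ℝ)) ^ 2 * dirichlet G x := by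
  set W := ∑ i ∈ T, (G.degree i : ℝ) with hW
  have hxv : x v = 0 := by by_contra h; exact hv (hT v h)
  set E := G.edgeFinset.filter fun e => edgeLength x e ≠ 0 with hE
  have hsum : ∀ f : Sym2 V → ℝ, (∀ e, edgeLength x e = 0 → f e = 0) →
      ∑ e ∈ G.edgeFinset, f e = ∑ e ∈ E, f e := fun f hf => by
    rw [hE, Finset.sum_filter]
    exact Finset.sum_congr rfl fun e _ => by
      by_cases h : edgeLength x e = 0
      · simp [h, hf e h]
      · simp [h]
  -- Cauchy–Schwarz over the varying edges only, of which there are at most W. A path to the zero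
  -- node v then bounds each coordinate, and a second factor W counts the nodes of T.
  have h1 : (∑ e ∈ G.edgeFinset, edgeLength x e) ^ 2 ≤ W * dirichlet G x := by
    rw [hsum _ fun e he => he, dirichlet_eq, hsum _ fun e he => by simp [he]]
    refine sq_sum_le_card_mul_sum_sq.trans ?_
    exact mul_le_mul_of_nonneg_right (card_edgeLength_ne_zero_le hT)
      (Finset.sum_nonneg fun e _ => sq_nonneg _)
  have h2 : ∀ i, x i ^ 2 ≤ W * dirichlet G x := fun i => by
    have := abs_sub_le_sum_edgeLength hG x i v
    rw [hxv, sub_zero] at this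
    rw [← sq_abs]
    exact (pow_le_pow_left₀ (abs_nonneg _) this 2).trans h1
  have h0 : 0 ≤ W * dirichlet G x := (sq_nonneg _).trans h1
  have hcard : (T.card : ℝ) ≤ W := by
    have := Finset.sum_le_sum fun i (_ : i ∈ T) => hdeg i
    simpa using this
  rw [EuclideanSpace.norm_sq_eq]
  simp only [Real.norm_eq_abs, sq_abs]
  calc ∑ i, x i ^ 2 = ∑ i ∈ T, x i ^ 2 := by
        refine (Finset.sum_subset (Finset.subset_univ T) fun i _ hi => ?_).symm
        have : x i = 0 := by by_contra h; exact hi (hT i h)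
        simp [this]
    _ ≤ ∑ i ∈ T, W * dirichlet G x := Finset.sum_le_sum fun i _ => h2 i
    _ = T.card * (W * dirichlet G x) := by simp
    _ ≤ W * (W * dirichlet G x) := mul_le_mul_of_nonneg_right hcard h0
    _ = W ^ 2 * dirichlet G x := by ring

end Edges

end FlowDiffusion

namespace FlowDiffusion

/-! ### Existence of minimizers and comparison of the two objectives. -/

section Existence

variable {V : Type u} [Fintype V] [DecidableEq V] {G : SimpleGraph V} [DecidableRel G.Adj]
  {Δ : V → ℝ} {q μ : ℝ}

lemma isCompact_box (b : V → ℝ) :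
    IsCompact {x : EuclideanSpace ℝ V | ∀ i, 0 ≤ x i ∧ x i ≤ b i} := by
  have h := (isCompact_univ_pi fun i : V => isCompact_Icc (a := (0 : ℝ)) (b := b i)).image
    (PiLp.continuous_toLp 2 fun _ : V => ℝ)
  convert h using 1
  ext x
  constructor
  · exact fun hx => ⟨x.ofLp, fun i _ => hx i, rfl⟩
  · rintro ⟨y, hy, rfl⟩ i
    exact hy i (Set.mem_univ i)

/-- Split x into its minimum x v and its total variation E. Young's inequality with weight |Δ| + 1
lets the q-power term dominate (|Δ| + 1)E, beating the linear term's |Δ|E, while the minimum is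
penalized with slope vol(G) - |Δ| > 0. -/
lemma dualObj_coercive (hG : G.Connected) (hΔ : ∀ i, 0 ≤ Δ i) (hM : mass Δ < vol G) {p : ℝ}
    (hpq : p.HolderConjugate q) :
    ∃ c C : ℝ, 0 < c ∧ ∀ x ∈ orthant V, ∀ i, c * x i ≤ dualObj G Δ q x + C := by
  refine ⟨min 1 (vol G - mass Δ), (G.edgeFinset.card : ℝ) * ((mass Δ + 1) ^ p / p),
    lt_min one_pos (sub_pos.2 hM), fun x hx i => ?_⟩
  have := hG.nonempty
  obtain ⟨v, hv⟩ := Finite.exists_min fun i => x i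
  set E := ∑ e ∈ G.edgeFinset, edgeLength x e with hE
  set δ := vol G - mass Δ with hδ
  have hm0 : 0 ≤ mass Δ := Finset.sum_nonneg fun i _ => hΔ i
  have hxE : ∀ i, x i - x v ≤ E := fun i =>
    (le_abs_self _).trans (abs_sub_le_sum_edgeLength hG x i v)
  have hE0 : 0 ≤ E := Finset.sum_nonneg fun e _ => edgeLength_nonneg x e
  have h1 : (mass Δ + 1) * E ≤ (G.edgeFinset.card : ℝ) * ((mass Δ + 1) ^ p / p)
      + 1 / q * ∑ e ∈ G.edgeFinset, edgeLength x e ^ q := by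
    have h2 : ∑ e ∈ G.edgeFinset, (mass Δ + 1) * edgeLength x e ≤
        ∑ e ∈ G.edgeFinset, ((mass Δ + 1) ^ p / p + 1 / q * edgeLength x e ^ q) :=
      Finset.sum_le_sum fun e _ => by
        have := Real.young_inequality_of_nonneg (by linarith : 0 ≤ mass Δ + 1)
          (edgeLength_nonneg x e) hpq
        rw [one_div_mul_eq_div]
        exact this
    rw [← Finset.mul_sum, Finset.sum_add_distrib, ← Finset.mul_sum, Finset.sum_const,
      nsmul_eq_mul] at h2
    exact h2
  have h3 : ∑ i, x i * (Δ i - G.degree i) ≤ mass Δ * E - δ * x v := by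
    have h4 : ∑ i, x i * (Δ i - G.degree i) ≤ ∑ i, (E * Δ i + x v * (Δ i - G.degree i)) := by
      refine Finset.sum_le_sum fun i _ => ?_
      have ha : (x i - x v) * Δ i ≤ E * Δ i := mul_le_mul_of_nonneg_right (hxE i) (hΔ i)
      have hb : 0 ≤ (x i - x v) * (G.degree i : ℝ) :=
        mul_nonneg (sub_nonneg.2 (hv i)) (by positivity)
      linarith
    rw [Finset.sum_add_distrib, ← Finset.mul_sum, ← Finset.mul_sum, Finset.sum_sub_distrib] at h4
    rw [hδ, vol]
    rw [mass] at *
    linarith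
  have h5 : min 1 δ * x i ≤ E + δ * x v := by
    have ha : min 1 δ * (x i - x v) ≤ 1 * E :=
      mul_le_mul (min_le_left _ _) (hxE i) (sub_nonneg.2 (hv i)) zero_le_one
    have hb : min 1 δ * x v ≤ δ * x v := mul_le_mul_of_nonneg_right (min_le_right _ _) (hx v)
    linarith
  rw [dualObj]
  linarith

lemma exists_isOptimal (hG : G.Connected) (hΔ : ∀ i, 0 ≤ Δ i) (hM : mass Δ < vol G) {p : ℝ}
    (hpq : p.HolderConjugate q) {f : EuclideanSpace ℝ V → ℝ} (hf : Continuous f)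
    (hle : ∀ x, dualObj G Δ q x ≤ f x) : ∃ x, IsOptimal f x := by
  obtain ⟨c, C, hc, hC⟩ := dualObj_coercive hG hΔ hM hpq
  have := hG.nonempty
  set B := (f 0 + C) / c with hB
  have hB0 : 0 ≤ B := by
    have h1 := hC 0 (fun i => by simp) (Classical.arbitrary V)
    have h2 := hle 0
    simp only [PiLp.zero_apply, mul_zero] at h1
    exact div_nonneg (by linarith) hc.le
  obtain ⟨x, hx, hmin⟩ := (isCompact_box fun _ : V => B).exists_isMinOn
    ⟨0, fun i => ⟨by simp, by simpa using hB0⟩⟩ hf.continuousOn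
  refine ⟨x, fun i => (hx i).1, fun y hy => ?_⟩
  by_cases hyB : ∀ i, y i ≤ B
  · exact hmin fun i => ⟨hy i, hyB i⟩
  · push Not at hyB
    obtain ⟨i, hi⟩ := hyB
    have h1 := hC y hy i
    have h2 := hle y
    rw [hB, div_lt_iff₀ hc] at hi
    have h3 : f x ≤ f 0 := hmin fun i => ⟨by simp, by simpa using hB0⟩
    linarith

lemma continuous_dualObj (hq : 0 < q) : Continuous (dualObj G Δ q) := by
  have h : ∀ e, Continuous fun x : EuclideanSpace ℝ V => edgeLength x e := fun e => by
    induction e using Sym2.ind with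
    | _ a b => simp only [edgeLength_mk]; fun_prop
  unfold dualObj
  refine Continuous.sub (continuous_const.mul (continuous_finsetSum _ fun e _ =>
    (h e).rpow_const fun _ => Or.inr hq.le)) (by fun_prop)

lemma sq_rpow_half {t : ℝ} (ht : 0 ≤ t) : (t ^ 2) ^ (q / 2) = t ^ q := by
  rw [← Real.rpow_natCast, ← Real.rpow_mul ht]
  congr 1
  push_cast
  ring

lemma dualObj_le_smoothObj (hq : 0 < q) (x : EuclideanSpace ℝ V) :
    dualObj G Δ q x ≤ smoothObj G Δ q μ x := by
  unfold dualObj smoothObj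
  refine sub_le_sub_right (mul_le_mul_of_nonneg_left (Finset.sum_le_sum fun e _ => ?_)
    (by positivity)) _
  rw [← sq_rpow_half (edgeLength_nonneg x e)]
  exact Real.rpow_le_rpow (sq_nonneg _) (by nlinarith [sq_nonneg μ]) (by positivity)

lemma smoothObj_le_dualObj_add (hq : 0 < q) (hq2 : q ≤ 2) (hμ : 0 < μ) (x : EuclideanSpace ℝ V) :
    smoothObj G Δ q μ x ≤ dualObj G Δ q x + 1 / q * (G.edgeFinset.card * μ ^ q) := by
  have h : ∑ e ∈ G.edgeFinset, (edgeLength x e ^ 2 + μ ^ 2) ^ (q / 2) ≤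
      ∑ e ∈ G.edgeFinset, (edgeLength x e ^ q + μ ^ q) := Finset.sum_le_sum fun e _ => by
    rw [← sq_rpow_half (edgeLength_nonneg x e), ← sq_rpow_half hμ.le]
    exact Real.rpow_add_le_add_rpow (sq_nonneg _) (sq_nonneg _) (by positivity) (by linarith)
  rw [Finset.sum_add_distrib, Finset.sum_const, nsmul_eq_mul] at h
  have := mul_le_mul_of_nonneg_left h (show 0 ≤ 1 / q by positivity)
  unfold smoothObj dualObj
  linarith

/-- On an edge of length zero the smoothed term is exactly μ^q, so no error arises there. The
edge-count term on the left matches the one in `smoothObj_le_dualObj_add` and cancels against it. -/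
lemma dualObj_add_le_smoothObj_add (hq : 0 < q) (hμ : 0 < μ) {x : EuclideanSpace ℝ V}
    {T : Finset V} (hT : ∀ i, x i ≠ 0 → i ∈ T) :
    dualObj G Δ q x + 1 / q * (G.edgeFinset.card * μ ^ q) ≤
      smoothObj G Δ q μ x + 1 / q * ((∑ i ∈ T, (G.degree i : ℝ)) * μ ^ q) := by
  have hμq : 0 < μ ^ q := Real.rpow_pos_of_pos hμ q
  have h : ∑ e ∈ G.edgeFinset, (edgeLength x e ^ q + μ ^ q) ≤
      ∑ e ∈ G.edgeFinset, ((edgeLength x e ^ 2 + μ ^ 2) ^ (q / 2)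
        + (if edgeLength x e ≠ 0 then 1 else 0) * μ ^ q) := Finset.sum_le_sum fun e _ => by
    by_cases he : edgeLength x e = 0
    · simp [he, Real.zero_rpow hq.ne', sq_rpow_half hμ.le]
    · simp only [he, ne_eq, not_false_eq_true, if_true, one_mul]
      rw [← sq_rpow_half (edgeLength_nonneg x e)]
      exact add_le_add_left (Real.rpow_le_rpow (sq_nonneg _) (by nlinarith [sq_nonneg μ])
        (by positivity)) _
  rw [Finset.sum_add_distrib, Finset.sum_const, nsmul_eq_mul, Finset.sum_add_distrib,
    ← Finset.sum_mul, Finset.sum_boole] at h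
  have h1 := mul_le_mul_of_nonneg_right (card_edgeLength_ne_zero_le (G := G) hT) hμq.le
  have := mul_le_mul_of_nonneg_left (h.trans (add_le_add le_rfl h1))
    (show 0 ≤ 1 / q by positivity)
  unfold smoothObj dualObj
  linarith

end Existence

/-! ### Strong convexity, initial gap, and progress of one step. -/

section Progress

variable {V : Type u} [Fintype V] [DecidableEq V] {G : SimpleGraph V} [DecidableRel G.Adj]
  {Δ : V → ℝ} {p q μ : ℝ}

lemma exists_strongConvexityParam (hG : G.Connected) (hq1 : 1 < q) (hq : q ≤ 2) (hμ : 0 < μ)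
    (hpq : (p - 1) * (q - 1) = 1) (hΔ : ∀ i, 0 ≤ Δ i)
    (hM : mass Δ < vol G) (hdeg : ∀ i, (1 : ℝ) ≤ G.degree i) {xs : EuclideanSpace ℝ V}
    (hxs : xs ∈ settled G Δ q μ) {u : V} (hu : xs u ≠ 0) :
    ∃ γ : ℝ, 1 / ((p - 1) * mass Δ ^ p) < γ ∧
      IsStrongConvexityParam (smoothObj G Δ q μ) (localSet G Δ p μ xs) γ := by
  set W := ∑ i ∈ supp xs, (G.degree i : ℝ) with hW
  have hWM : W < mass Δ := vol_supp_lt hG hΔ hM hμ hxs hu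
  have hW0 : 0 < W := by
    have h := Finset.single_le_sum (f := fun k => (G.degree k : ℝ)) (fun k _ => by positivity)
      (mem_supp.2 hu)
    have := hdeg u
    linarith
  have hM0 : 0 < mass Δ := hW0.trans hWM
  have hpe : 1 / (p - 1) = q - 1 := by
    have : p - 1 ≠ 0 := fun h => by simp [h] at hpq
    field_simp
    linarith
  have hRpow : (mass Δ ^ (2 * p - 2)) ^ (q / 2 - 1) = mass Δ ^ (2 - p) := by
    rw [← Real.rpow_mul hM0.le]
    congr 1
    nlinarith
  obtain ⟨v, hv⟩ := exists_eq_zero hΔ hM hxs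
  -- Edge curvature on U divided by the Poincaré constant. It equals (q-1)|Δ|^(2-p)/W², and W < |Δ|
  -- with q - 1 = 1/(p-1) gives the claimed bound.
  refine ⟨(q - 1) * (mass Δ ^ (2 * p - 2)) ^ (q / 2 - 1) / W ^ 2, ?_, fun x hx y hy => ?_⟩
  · rw [hRpow, ← div_div, hpe, div_lt_div_iff₀ (Real.rpow_pos_of_pos hM0 p) (by positivity)]
    have h1 : mass Δ ^ (2 - p) * mass Δ ^ p = mass Δ ^ 2 := by
      rw [← Real.rpow_add hM0, ← Real.rpow_natCast]
      congr 1
      push_cast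
      ring
    have h2 : W ^ 2 < mass Δ ^ 2 := pow_lt_pow_left₀ hWM hW0.le two_ne_zero
    rw [mul_assoc, h1]
    exact mul_lt_mul_of_pos_left h2 (by linarith)
  · rw [inner_gradient_smoothObj G Δ (by linarith) hμ]
    have h1 := smoothObj_lower G Δ hq1 hq hμ x y hx.2 hy.2
    have h2 : ‖y - x‖ ^ 2 ≤ W ^ 2 * dirichlet G (y - x) := by
      refine norm_sq_le_dirichlet hG hdeg (T := supp xs) (fun i hi => ?_) (v := v)
        (by simpa [mem_supp] using hv)
      rw [mem_supp]
      intro h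
      have hx0 : x i = 0 := by by_contra h'; exact hx.1 i h' h
      have hy0 : y i = 0 := by by_contra h'; exact hy.1 i h' h
      simp [hx0, hy0] at hi
    refine le_trans (add_le_add le_rfl ?_) h1
    have h3 : 0 ≤ (q - 1) * (mass Δ ^ (2 * p - 2)) ^ (q / 2 - 1) :=
      mul_nonneg (by linarith) (by positivity)
    calc _ ≤ (q - 1) * (mass Δ ^ (2 * p - 2)) ^ (q / 2 - 1) / W ^ 2 / 2 *
          (W ^ 2 * dirichlet G (y - x)) := mul_le_mul_of_nonneg_left h2 (by positivity)
      _ = (q - 1) * (mass Δ ^ (2 * p - 2)) ^ (q / 2 - 1) / 2 * dirichlet G (y - x) := by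
        field_simp
      _ = _ := rfl

/-- The objective gap at the origin. -/
lemma smoothObj_zero_sub_le (hG : G.Connected) (hq1 : 1 < q) (hq : q ≤ 2) (hμ : 0 < μ)
    (hμ1 : μ ≤ 1) (hpq : (p - 1) * (q - 1) = 1) (hΔ : ∀ i, 0 ≤ Δ i)
    (hM : mass Δ < vol G) (hdeg : ∀ i, (1 : ℝ) ≤ G.degree i) (h1M : 1 ≤ mass Δ)
    {xs : EuclideanSpace ℝ V} (hxs : xs ∈ settled G Δ q μ) :
    smoothObj G Δ q μ 0 - smoothObj G Δ q μ xs ≤ mass Δ ^ (p + 1) := by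
  have hM0 : 0 < mass Δ := by linarith
  obtain ⟨v, hv⟩ := exists_eq_zero hΔ hM hxs
  have hlen : ∀ e ∈ G.edgeFinset, edgeLength xs e ≤
      (if edgeLength xs e ≠ 0 then 1 else 0) * mass Δ ^ (p - 1) := by
    intro e he
    by_cases h0 : edgeLength xs e = 0
    · simp [h0]
    · simp only [h0, ne_eq, not_false_eq_true, if_true, one_mul]
      induction e using Sym2.ind with
      | _ a b =>
        rw [SimpleGraph.mem_edgeFinset, SimpleGraph.mem_edgeSet] at he
        have h1 := sq_add_sq_le_of_settled hq1 hq hμ hμ1 hpq hΔ hdeg h1M hxs he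
        rw [show 2 * p - 2 = (p - 1) * 2 by ring, Real.rpow_mul hM0.le, Real.rpow_two] at h1
        rw [edgeLength_mk]
        exact abs_le_of_sq_le_sq (by nlinarith) (by positivity)
  -- At most |Δ| varying edges, each of length at most |Δ|^(p-1), connect i to a zero of xs.
  have hx : ∀ i, xs i ≤ mass Δ ^ p := fun i => by
    have h1 := abs_sub_le_sum_edgeLength hG xs i v
    have h2 := Finset.sum_le_sum hlen
    rw [← Finset.sum_mul, Finset.sum_boole] at h2
    have h3 := (card_edgeLength_ne_zero_le (G := G) (x := xs) (T := supp xs)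
      fun i => mem_supp.2).trans (vol_supp_le hΔ hxs)
    have h4 := mul_le_mul_of_nonneg_right h3 (Real.rpow_nonneg hM0.le (p - 1))
    have h5 : mass Δ * mass Δ ^ (p - 1) = mass Δ ^ p := by
      rw [Real.rpow_sub_one hM0.ne']
      field_simp
    rw [hv, sub_zero] at h1
    have := le_abs_self (xs i)
    linarith
  have h1 := smoothObj_tangent_le G Δ hq1 hq hμ 0 xs
  have h2 : ∑ i, -(Δ i * mass Δ ^ p) ≤
      ∑ i, dualGrad G Δ q μ 0 i * (xs i - (0 : EuclideanSpace ℝ V) i) := by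
    refine Finset.sum_le_sum fun i _ => ?_
    have h3 : dualGrad G Δ q μ 0 i = G.degree i - Δ i := by
      simp [dualGrad, smoothFlow_zero]
    have h4 : (0 : ℝ) ≤ G.degree i := by positivity
    rw [h3, PiLp.zero_apply, sub_zero]
    nlinarith [mul_nonneg h4 (hxs.1 i), mul_le_mul_of_nonneg_left (hx i) (hΔ i)]
  rw [Finset.sum_neg_distrib, ← Finset.sum_mul] at h2
  have h6 : (∑ i, Δ i) * mass Δ ^ p = mass Δ ^ (p + 1) := by
    rw [Real.rpow_add_one hM0.ne', mul_comm]; rfl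
  linarith

lemma mem_activeSet (hq : 0 < q) (hμ : 0 < μ) {x : EuclideanSpace ℝ V} {i : V} :
    i ∈ activeSet G Δ q μ x ↔ dualGrad G Δ q μ x i < 0 := by
  simp [activeSet, gradient_smoothObj_apply G Δ hq hμ]

lemma coordStep_eq (hq : 0 < q) (hμ : 0 < μ) (x : EuclideanSpace ℝ V) (i : V) :
    coordStep G Δ q μ x i = x + EuclideanSpace.single i
      (-dualGrad G Δ q μ x i / (G.degree i * μ ^ (q - 2))) := by
  rw [coordStep, gradient_smoothObj_apply G Δ hq hμ, sub_eq_add_neg, ← neg_smul]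
  congr 1
  ext k
  have : μ ^ (2 - q) = (μ ^ (q - 2))⁻¹ := by rw [← Real.rpow_neg hμ.le]; congr 1; ring
  by_cases h : k = i
  · subst h
    simp [this]
    ring
  · simp [h]

lemma lip_pos (hμ : 0 < μ) (hdeg : ∀ i, (1 : ℝ) ≤ G.degree i) (i : V) :
    0 < (G.degree i : ℝ) * μ ^ (q - 2) :=
  mul_pos (by linarith [hdeg i]) (Real.rpow_pos_of_pos hμ _)

lemma coordStep_mem_settled (hq1 : 1 < q) (hq : q ≤ 2) (hμ : 0 < μ)
    (hdeg : ∀ i, (1 : ℝ) ≤ G.degree i) {x : EuclideanSpace ℝ V} (hx : x ∈ settled G Δ q μ) {i : V}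
    (hi : i ∈ activeSet G Δ q μ x) : coordStep G Δ q μ x i ∈ settled G Δ q μ := by
  rw [mem_activeSet (by linarith) hμ] at hi
  have hL := lip_pos (q := q) hμ hdeg i
  rw [coordStep_eq (by linarith) hμ]
  refine add_single_mem_settled hq1 hq hμ hx (div_nonneg (by linarith) hL.le) ?_
  rw [mul_div_cancel₀ _ hL.ne']
  linarith

lemma smoothObj_coordStep_le (hq1 : 1 < q) (hq : q ≤ 2) (hμ : 0 < μ)
    (hdeg : ∀ i, (1 : ℝ) ≤ G.degree i) (x : EuclideanSpace ℝ V) (i : V) :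
    smoothObj G Δ q μ (coordStep G Δ q μ x i) ≤ smoothObj G Δ q μ x
      - dualGrad G Δ q μ x i ^ 2 / (2 * (G.degree i * μ ^ (q - 2))) := by
  have hL := lip_pos (q := q) hμ hdeg i
  rw [coordStep_eq (by linarith) hμ]
  refine (smoothObj_add_single_le G Δ hq1 hq hμ x i _).trans (le_of_eq ?_)
  set L := (G.degree i : ℝ) * μ ^ (q - 2)
  field_simp
  ring

lemma lip_le_maxLip (xs : EuclideanSpace ℝ V) {i : V} (hi : xs i ≠ 0) :
    (G.degree i : ℝ) * μ ^ (q - 2) ≤ maxLip G q μ xs :=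
  le_csSup (Set.toFinite _).bddAbove ⟨i, hi, rfl⟩

lemma maxLip_le (hμ : 0 < μ) (xs : EuclideanSpace ℝ V) {u : V} (hu : xs u ≠ 0) :
    maxLip G q μ xs ≤ maxDeg G xs * μ ^ (q - 2) := by
  refine csSup_le ⟨_, u, hu, rfl⟩ ?_
  rintro _ ⟨i, hi, rfl⟩
  exact mul_le_mul_of_nonneg_right (le_csSup (Set.toFinite _).bddAbove ⟨i, hi, rfl⟩)
    (Real.rpow_nonneg hμ.le _)

lemma settled_le_of_isOptimal (hG : G.Connected) (hq1 : 1 < q) (hq : q ≤ 2) (hμ : 0 < μ)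
    (hΔ : ∀ i, 0 ≤ Δ i) (hM : mass Δ < vol G) (hdeg : ∀ i, (1 : ℝ) ≤ G.degree i)
    {x xs : EuclideanSpace ℝ V} (hx : x ∈ settled G Δ q μ)
    (hxs : IsOptimal (smoothObj G Δ q μ) xs) (i : V) : x i ≤ xs i :=
  settled_le hG hq1 hq hμ hΔ hM hx hxs.1 (dualGrad_nonneg_of_isOptimal hq1 hq hμ hdeg hxs) i

lemma settled_subset_localSet (hG : G.Connected) (hq1 : 1 < q) (hq : q ≤ 2) (hμ : 0 < μ)
    (hμ1 : μ ≤ 1) (hpq : (p - 1) * (q - 1) = 1) (hΔ : ∀ i, 0 ≤ Δ i)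
    (hM : mass Δ < vol G) (hdeg : ∀ i, (1 : ℝ) ≤ G.degree i) (h1M : 1 ≤ mass Δ)
    {xs : EuclideanSpace ℝ V} (hxs : IsOptimal (smoothObj G Δ q μ) xs) :
    settled G Δ q μ ⊆ localSet G Δ p μ xs := by
  refine fun x hx => ⟨fun i hi => ?_, fun i j hij =>
    sq_add_sq_le_of_settled hq1 hq hμ hμ1 hpq hΔ hdeg h1M hx hij⟩
  have h1 := settled_le_of_isOptimal hG hq1 hq hμ hΔ hM hdeg hx hxs i
  have h2 := pos_of_mem_supp hx.1 (mem_supp.2 hi)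
  exact (h2.trans_le h1).ne'

/-- The optimality gap is controlled by the negative part of the gradient. -/
lemma gap_le_sum_sq {γ : ℝ} (hγ : 0 < γ) (hq : 0 < q) (hμ : 0 < μ) {x xs : EuclideanSpace ℝ V}
    (hle : ∀ i, x i ≤ xs i) {U : Set (EuclideanSpace ℝ V)} (hx : x ∈ U) (hxs : xs ∈ U)
    (hsc : IsStrongConvexityParam (smoothObj G Δ q μ) U γ) :
    2 * γ * (smoothObj G Δ q μ x - smoothObj G Δ q μ xs) ≤
      ∑ i ∈ activeSet G Δ q μ x, dualGrad G Δ q μ x i ^ 2 := by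
  have h1 := hsc x hx xs hxs
  rw [inner_gradient_smoothObj G Δ hq hμ, EuclideanSpace.norm_sq_eq] at h1
  simp only [Real.norm_eq_abs, sq_abs] at h1
  -- Completing the square handles negative entries; where the gradient is nonnegative, both terms
  -- are nonnegative because xs lies above x. This is why only the active set appears.
  have h2 : ∑ i, -(if dualGrad G Δ q μ x i < 0 then dualGrad G Δ q μ x i ^ 2 else 0) ≤
      ∑ i, (2 * γ * (dualGrad G Δ q μ x i * (xs - x) i) + γ ^ 2 * (xs - x) i ^ 2) := by
    refine Finset.sum_le_sum fun i _ => ?_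
    have hh : 0 ≤ (xs - x) i := by simpa using hle i
    split_ifs with hg
    · nlinarith [sq_nonneg (dualGrad G Δ q μ x i + γ * (xs - x) i)]
    · push Not at hg
      rw [neg_zero]
      positivity
  rw [Finset.sum_neg_distrib, ← Finset.sum_filter, Finset.sum_add_distrib, ← Finset.mul_sum,
    ← Finset.mul_sum] at h2
  have h3 : activeSet G Δ q μ x = Finset.univ.filter fun i => dualGrad G Δ q μ x i < 0 := by
    ext i; simp [mem_activeSet hq hμ]
  rw [h3]
  nlinarith

/-- One randomized step contracts the optimality gap. -/
lemma sum_activeSet_gap_le (hG : G.Connected) (hq1 : 1 < q) (hq : q ≤ 2) (hμ : 0 < μ)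
    (hμ1 : μ ≤ 1) (hpq : (p - 1) * (q - 1) = 1) (hΔ : ∀ i, 0 ≤ Δ i)
    (hM : mass Δ < vol G) (hdeg : ∀ i, (1 : ℝ) ≤ G.degree i) (h1M : 1 ≤ mass Δ)
    {xs : EuclideanSpace ℝ V} (hxs : IsOptimal (smoothObj G Δ q μ) xs) {u : V} (hu : xs u ≠ 0)
    {γ : ℝ} (hγ : 0 < γ)
    (hsc : IsStrongConvexityParam (smoothObj G Δ q μ) (localSet G Δ p μ xs) γ)
    {x : EuclideanSpace ℝ V} (hx : x ∈ settled G Δ q μ) :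
    ∑ i ∈ activeSet G Δ q μ x,
        (smoothObj G Δ q μ (coordStep G Δ q μ x i) - smoothObj G Δ q μ xs) ≤
      (activeSet G Δ q μ x).card * ((1 - γ / (mass Δ * maxLip G q μ xs))
        * (smoothObj G Δ q μ x - smoothObj G Δ q μ xs)) := by
  set S := activeSet G Δ q μ x with hS
  set L := maxLip G q μ xs with hL
  set gap := smoothObj G Δ q μ x - smoothObj G Δ q μ xs with hgap
  have hM0 : 0 < mass Δ := by linarith
  have hL0 : 0 < L := (lip_pos hμ hdeg u).trans_le (lip_le_maxLip xs hu)
  have hsub := settled_subset_localSet hG hq1 hq hμ hμ1 hpq hΔ hM hdeg h1M hxs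
  have hxsS := settled_of_isOptimal hq1 hq hμ hdeg hxs
  have hle := settled_le_of_isOptimal hG hq1 hq hμ hΔ hM hdeg hx hxs
  have h1 := gap_le_sum_sq hγ (by linarith) hμ hle (hsub hx) (hsub hxsS) hsc
  have hgap0 : 0 ≤ gap := sub_nonneg.2 (hxs.2 x hx.1)
  -- The stepped point is again settled, hence below xs, and its i-th coordinate is positive.
  have hST : ∀ i ∈ S, xs i ≠ 0 := fun i hi => by
    have h2 := settled_le_of_isOptimal hG hq1 hq hμ hΔ hM hdeg
      (coordStep_mem_settled hq1 hq hμ hdeg hx hi) hxs i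
    rw [mem_activeSet (by linarith) hμ] at hi
    rw [coordStep_eq (by linarith) hμ] at h2
    have h3 : 0 < -dualGrad G Δ q μ x i / (G.degree i * μ ^ (q - 2)) :=
      div_pos (by linarith) (lip_pos hμ hdeg i)
    simp only [PiLp.add_apply, PiLp.single_apply, if_true] at h2
    have := hx.1 i
    exact (by linarith : 0 < xs i).ne'
  have hcard : (S.card : ℝ) ≤ mass Δ := by
    have h2 : S ⊆ supp xs := fun i hi => mem_supp.2 (hST i hi)
    have h3 := Finset.sum_le_sum_of_subset_of_nonneg h2
      (f := fun i => (G.degree i : ℝ)) fun i _ _ => by positivity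
    have h4 := Finset.sum_le_sum fun i (_ : i ∈ S) => hdeg i
    rw [Finset.sum_const, nsmul_one] at h4
    exact h4.trans (h3.trans (vol_supp_le hΔ hxsS))
  have h2 : ∑ i ∈ S, (smoothObj G Δ q μ (coordStep G Δ q μ x i) - smoothObj G Δ q μ xs) ≤
      ∑ i ∈ S, (gap - dualGrad G Δ q μ x i ^ 2 / (2 * L)) := by
    refine Finset.sum_le_sum fun i hi => ?_
    have h3 := smoothObj_coordStep_le (Δ := Δ) hq1 hq hμ hdeg x i
    have h4 : dualGrad G Δ q μ x i ^ 2 / (2 * L) ≤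
        dualGrad G Δ q μ x i ^ 2 / (2 * (G.degree i * μ ^ (q - 2))) :=
      div_le_div_of_nonneg_left (sq_nonneg _) (by linarith [lip_pos (q := q) hμ hdeg i])
        (by linarith [lip_le_maxLip (G := G) (q := q) (μ := μ) xs (hST i hi)])
    linarith
  refine h2.trans ?_
  rw [Finset.sum_sub_distrib, Finset.sum_const, nsmul_eq_mul, ← Finset.sum_div]
  -- The total decrease is at least γ gap / L; since |S| ≤ |Δ|, the average over S is at least γ gap
  -- / (|Δ| L).
  have h5 : (S.card : ℝ) * (γ / (mass Δ * L) * gap) ≤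
      (∑ i ∈ S, dualGrad G Δ q μ x i ^ 2) / (2 * L) := by
    rw [le_div_iff₀ (by positivity)]
    calc (S.card : ℝ) * (γ / (mass Δ * L) * gap) * (2 * L)
        = S.card / mass Δ * (2 * γ * gap) := by field_simp
      _ ≤ 1 * (2 * γ * gap) := mul_le_mul_of_nonneg_right ((div_le_one hM0).2 hcard)
        (by positivity)
      _ ≤ _ := by rw [one_mul]; exact h1
  linarith

end Progress

end FlowDiffusion

namespace FlowDiffusion

/-! ### Expectations under discrete laws as extended nonnegative sums. -/

section PMFSums

variable {α β : Type*}

lemma tsum_bind_mul (p : PMF α) (κ : α → PMF β) (g : β → ENNReal) :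
    ∑' y, (p.bind κ) y * g y = ∑' a, p a * ∑' y, κ a y * g y := by
  simp only [PMF.bind_apply, ← ENNReal.tsum_mul_right, ← ENNReal.tsum_mul_left]
  rw [ENNReal.tsum_comm]
  simp only [mul_assoc]

lemma tsum_pure_mul (a : α) (g : α → ENNReal) : ∑' y, (PMF.pure a) y * g y = g a := by
  rw [tsum_eq_single a]
  · simp
  · intro b hb
    simp [hb]

lemma tsum_map_mul (p : PMF α) (f : α → β) (g : β → ENNReal) :
    ∑' y, (p.map f) y * g y = ∑' a, p a * g (f a) := by
  rw [PMF.map, tsum_bind_mul]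
  simp only [Function.comp_apply, tsum_pure_mul]

lemma tsum_uniformOfFinset_mul [Fintype α] (S : Finset α) (hS : S.Nonempty) (g : α → ENNReal) :
    ∑' a, (PMF.uniformOfFinset S hS) a * g a = (S.card : ENNReal)⁻¹ * ∑ a ∈ S, g a := by
  classical
  rw [tsum_fintype, Finset.mul_sum, ← Finset.sum_subset (Finset.subset_univ S)]
  · exact Finset.sum_congr rfl fun a ha => by rw [PMF.uniformOfFinset_apply_of_mem hS ha]
  · intro a _ ha
    rw [PMF.uniformOfFinset_apply_of_notMem hS ha, zero_mul]

variable [MeasurableSpace α] [MeasurableSingletonClass α]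

lemma ae_mem_support (p : PMF α) : ∀ᵐ x ∂p.toMeasure, x ∈ p.support := by
  have h := ae_restrict_mem (μ := p.toMeasure) p.support_countable.measurableSet
  rwa [PMF.restrict_toMeasure_support] at h

/-- Subtracting a lower bound moves the expectation into `ENNReal`, where the recursion over
iterations needs no summability side conditions. -/
lemma integral_sub_eq_toReal_tsum (p : PMF α) {f : α → ℝ} (hf : Integrable f p.toMeasure) {c : ℝ}
    (hc : ∀ x ∈ p.support, c ≤ f x) :
    ∫ x, f x ∂p.toMeasure - c = (∑' x, p x * ENNReal.ofReal (f x - c)).toReal := by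
  have h1 : ∫ x, f x ∂p.toMeasure - c = ∫ x, (f x - c) ∂p.toMeasure := by
    rw [integral_sub hf (integrable_const c)]
    simp
  rw [h1, PMF.integral_eq_tsum p (fun x => f x - c) (hf.sub (integrable_const c)), ENNReal.tsum_toReal_eq fun x =>
    ENNReal.mul_ne_top (p.apply_ne_top x) ENNReal.ofReal_ne_top]
  refine tsum_congr fun x => ?_
  by_cases hx : x ∈ p.support
  · rw [ENNReal.toReal_mul, ENNReal.toReal_ofReal (sub_nonneg.2 (hc x hx)), smul_eq_mul]
  · rw [PMF.mem_support_iff, not_not] at hx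
    simp [hx]

end PMFSums

/-! ### Contraction of the expected gap along the iterates. -/

section Expectation

variable {V : Type u} [Fintype V] [DecidableEq V] {G : SimpleGraph V} [DecidableRel G.Adj]
  {Δ : V → ℝ} {p q μ : ℝ}

lemma stepLaw_support_subset (hq1 : 1 < q) (hq : q ≤ 2) (hμ : 0 < μ)
    (hdeg : ∀ i, (1 : ℝ) ≤ G.degree i) {x : EuclideanSpace ℝ V} (hx : x ∈ settled G Δ q μ) :
    (stepLaw G Δ q μ x).support ⊆ settled G Δ q μ := by
  intro y hy
  rw [stepLaw] at hy
  split_ifs at hy with h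
  · rw [PMF.support_map] at hy
    obtain ⟨i, hi, rfl⟩ := hy
    rw [PMF.mem_support_uniformOfFinset_iff] at hi
    exact coordStep_mem_settled hq1 hq hμ hdeg hx hi
  · rw [PMF.support_pure, Set.mem_singleton_iff] at hy
    exact hy ▸ hx

lemma iterateLaw_support_subset (hq1 : 1 < q) (hq : q ≤ 2) (hμ : 0 < μ)
    (hdeg : ∀ i, (1 : ℝ) ≤ G.degree i) (k : ℕ) :
    (iterateLaw G Δ q μ k).support ⊆ settled G Δ q μ := by
  induction k with
  | zero =>
    intro y hy
    rw [iterateLaw, PMF.support_pure, Set.mem_singleton_iff] at hy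
    exact hy ▸ zero_mem_settled
  | succ k ih =>
    intro y hy
    rw [iterateLaw, PMF.mem_support_bind_iff] at hy
    obtain ⟨x, hx, hxy⟩ := hy
    exact stepLaw_support_subset hq1 hq hμ hdeg (ih hx) hxy

lemma integrable_iterateLaw (hG : G.Connected) (hq1 : 1 < q) (hq : q ≤ 2) (hμ : 0 < μ)
    (hΔ : ∀ i, 0 ≤ Δ i) (hM : mass Δ < vol G) (hdeg : ∀ i, (1 : ℝ) ≤ G.degree i)
    {xs : EuclideanSpace ℝ V} (hxs : IsOptimal (smoothObj G Δ q μ) xs)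
    {f : EuclideanSpace ℝ V → ℝ} (hf : Continuous f) (k : ℕ) :
    Integrable f (iterateLaw G Δ q μ k).toMeasure := by
  obtain ⟨B, hB⟩ := (isCompact_box fun i => xs i).exists_bound_of_continuousOn hf.continuousOn
  refine Integrable.of_bound hf.aestronglyMeasurable B ?_
  filter_upwards [ae_mem_support (iterateLaw G Δ q μ k)] with x hx
  have hx' := iterateLaw_support_subset hq1 hq hμ hdeg k hx
  exact hB x fun i => ⟨hx'.1 i, settled_le_of_isOptimal hG hq1 hq hμ hΔ hM hdeg hx' hxs i⟩

lemma tsum_stepLaw_gap_le (hG : G.Connected) (hq1 : 1 < q) (hq : q ≤ 2) (hμ : 0 < μ)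
    (hμ1 : μ ≤ 1) (hpq : (p - 1) * (q - 1) = 1) (hΔ : ∀ i, 0 ≤ Δ i)
    (hM : mass Δ < vol G) (hdeg : ∀ i, (1 : ℝ) ≤ G.degree i) (h1M : 1 ≤ mass Δ)
    {xs : EuclideanSpace ℝ V} (hxs : IsOptimal (smoothObj G Δ q μ) xs) {u : V} (hu : xs u ≠ 0)
    {γ : ℝ} (hγ : 0 < γ)
    (hsc : IsStrongConvexityParam (smoothObj G Δ q μ) (localSet G Δ p μ xs) γ)
    {x : EuclideanSpace ℝ V} (hx : x ∈ settled G Δ q μ) :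
    ∑' y, stepLaw G Δ q μ x y * ENNReal.ofReal (smoothObj G Δ q μ y - smoothObj G Δ q μ xs) ≤
      ENNReal.ofReal (Real.exp (-(γ / (mass Δ * maxLip G q μ xs)))) *
        ENNReal.ofReal (smoothObj G Δ q μ x - smoothObj G Δ q μ xs) := by
  set S := activeSet G Δ q μ x with hS
  have hgap0 : 0 ≤ smoothObj G Δ q μ x - smoothObj G Δ q μ xs := sub_nonneg.2 (hxs.2 x hx.1)
  rw [stepLaw]
  split_ifs with h
  · have hcard : (0 : ℝ) < S.card := by exact_mod_cast h.card_pos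
    rw [tsum_map_mul, tsum_uniformOfFinset_mul, ← ENNReal.ofReal_sum_of_nonneg fun i hi =>
      sub_nonneg.2 (hxs.2 _ (coordStep_mem_settled hq1 hq hμ hdeg hx hi).1),
      ← ENNReal.ofReal_natCast, ← ENNReal.ofReal_inv_of_pos hcard,
      ← ENNReal.ofReal_mul (by positivity), ← ENNReal.ofReal_mul (by positivity)]
    refine ENNReal.ofReal_le_ofReal ?_
    rw [inv_mul_le_iff₀ hcard]
    refine (sum_activeSet_gap_le hG hq1 hq hμ hμ1 hpq hΔ hM hdeg h1M hxs hu hγ hsc hx).trans ?_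
    refine mul_le_mul_of_nonneg_left (mul_le_mul_of_nonneg_right ?_ hgap0) hcard.le
    linarith [Real.add_one_le_exp (-(γ / (mass Δ * maxLip G q μ xs)))]
  · rw [tsum_pure_mul]
    -- With no negative gradient entry the gap bound has right-hand side 0, so x is already optimal.
    have hsub := settled_subset_localSet hG hq1 hq hμ hμ1 hpq hΔ hM hdeg h1M hxs
    have h1 := gap_le_sum_sq hγ (by linarith) hμ
      (settled_le_of_isOptimal hG hq1 hq hμ hΔ hM hdeg hx hxs) (hsub hx)
      (hsub (settled_of_isOptimal hq1 hq hμ hdeg hxs)) hsc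
    rw [Finset.not_nonempty_iff_eq_empty.1 h, Finset.sum_empty] at h1
    rw [ENNReal.ofReal_of_nonpos (by
      by_contra! hpos
      have := mul_pos hγ hpos
      linarith)]
    exact zero_le

lemma expectedValue_sub_le (hG : G.Connected) (hq1 : 1 < q) (hq : q ≤ 2) (hμ : 0 < μ)
    (hμ1 : μ ≤ 1) (hpq : (p - 1) * (q - 1) = 1) (hΔ : ∀ i, 0 ≤ Δ i)
    (hM : mass Δ < vol G) (hdeg : ∀ i, (1 : ℝ) ≤ G.degree i) (h1M : 1 ≤ mass Δ)
    {xs : EuclideanSpace ℝ V} (hxs : IsOptimal (smoothObj G Δ q μ) xs) {u : V} (hu : xs u ≠ 0)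
    {γ : ℝ} (hγ : 0 < γ)
    (hsc : IsStrongConvexityParam (smoothObj G Δ q μ) (localSet G Δ p μ xs) γ) (k : ℕ) :
    expectedValue G Δ q μ (smoothObj G Δ q μ) k - smoothObj G Δ q μ xs ≤
      Real.exp (-(γ / (mass Δ * maxLip G q μ xs)) * k) * mass Δ ^ (p + 1) := by
  set r := -(γ / (mass Δ * maxLip G q μ xs)) with hr
  have hsupp := iterateLaw_support_subset (Δ := Δ) hq1 hq hμ hdeg
  have hk : ∑' y, iterateLaw G Δ q μ k y *
      ENNReal.ofReal (smoothObj G Δ q μ y - smoothObj G Δ q μ xs) ≤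
        ENNReal.ofReal (Real.exp (r * k) * mass Δ ^ (p + 1)) := by
    induction k with
    | zero =>
      rw [iterateLaw, tsum_pure_mul]
      simpa using ENNReal.ofReal_le_ofReal (smoothObj_zero_sub_le hG hq1 hq hμ hμ1 hpq hΔ hM hdeg
        h1M (settled_of_isOptimal hq1 hq hμ hdeg hxs))
    | succ k ih =>
      rw [iterateLaw, tsum_bind_mul]
      have h1 : ∀ x, iterateLaw G Δ q μ k x * ∑' y, stepLaw G Δ q μ x y *
          ENNReal.ofReal (smoothObj G Δ q μ y - smoothObj G Δ q μ xs) ≤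
          ENNReal.ofReal (Real.exp r) * (iterateLaw G Δ q μ k x *
            ENNReal.ofReal (smoothObj G Δ q μ x - smoothObj G Δ q μ xs)) := fun x => by
        by_cases hx : x ∈ (iterateLaw G Δ q μ k).support
        · rw [mul_left_comm]
          exact mul_le_mul_right (tsum_stepLaw_gap_le hG hq1 hq hμ hμ1 hpq hΔ hM hdeg h1M hxs hu
            hγ hsc (hsupp k hx)) _
        · rw [PMF.mem_support_iff, not_not] at hx
          simp [hx]
      refine (ENNReal.tsum_le_tsum h1).trans ?_
      rw [ENNReal.tsum_mul_left]
      refine (mul_le_mul_right ih _).trans (le_of_eq ?_)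
      rw [← ENNReal.ofReal_mul (Real.exp_pos _).le, ← mul_assoc, ← Real.exp_add]
      congr 3
      push_cast
      ring
  rw [expectedValue, integral_sub_eq_toReal_tsum _
    (integrable_iterateLaw hG hq1 hq hμ hΔ hM hdeg hxs (continuous_smoothObj G Δ (by linarith) hμ) k)
    fun x hx => hxs.2 x (hsupp k hx).1]
  exact ENNReal.toReal_le_of_le_ofReal
    (mul_nonneg (Real.exp_pos _).le (Real.rpow_nonneg (by linarith) _)) hk

/-- Iterates are nonnegative and lie below the minimizer, so they all vanish. -/
lemma expectedValue_of_isOptimal_zero (hG : G.Connected) (hq1 : 1 < q) (hq : q ≤ 2) (hμ : 0 < μ)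
    (hΔ : ∀ i, 0 ≤ Δ i) (hM : mass Δ < vol G) (hdeg : ∀ i, (1 : ℝ) ≤ G.degree i)
    {xs : EuclideanSpace ℝ V} (hxs : IsOptimal (smoothObj G Δ q μ) xs) (h0 : ∀ i, xs i = 0)
    (f : EuclideanSpace ℝ V → ℝ) (k : ℕ) : expectedValue G Δ q μ f k = f xs := by
  have h : ∀ᵐ x ∂(iterateLaw G Δ q μ k).toMeasure, f x = f xs := by
    filter_upwards [ae_mem_support (iterateLaw G Δ q μ k)] with x hx
    have hx' := iterateLaw_support_subset hq1 hq hμ hdeg k hx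
    congr 1
    ext i
    exact le_antisymm (settled_le_of_isOptimal hG hq1 hq hμ hΔ hM hdeg hx' hxs i)
      ((h0 i).symm ▸ hx'.1 i)
  rw [expectedValue, integral_congr_ae h]
  simp

/-- The optimality gap for the original objective in terms of the gap for the smoothed one. -/
lemma expectedValue_dualObj_sub_le (hG : G.Connected) (hq1 : 1 < q) (hq : q ≤ 2) (hμ : 0 < μ)
    (hΔ : ∀ i, 0 ≤ Δ i) (hM : mass Δ < vol G) (hdeg : ∀ i, (1 : ℝ) ≤ G.degree i)
    {xs : EuclideanSpace ℝ V} (hxs : IsOptimal (smoothObj G Δ q μ) xs)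
    {xF : EuclideanSpace ℝ V} (hxF : xF ∈ orthant V) (k : ℕ) :
    expectedValue G Δ q μ (dualObj G Δ q) k - dualObj G Δ q xF ≤
      expectedValue G Δ q μ (smoothObj G Δ q μ) k - smoothObj G Δ q μ xs
        + mass Δ * μ ^ q := by
  have hq0 : 0 < q := by linarith
  set c := 1 / q * (G.edgeFinset.card * μ ^ q) with hc
  have hcont := continuous_smoothObj G Δ hq0 hμ
  have h1 : expectedValue G Δ q μ (dualObj G Δ q) k ≤
      expectedValue G Δ q μ (smoothObj G Δ q μ) k + (mass Δ * μ ^ q - c) := by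
    have hi1 := integrable_iterateLaw hG hq1 hq hμ hΔ hM hdeg hxs
      (continuous_dualObj (G := G) (Δ := Δ) hq0) k
    have hi2 := integrable_iterateLaw hG hq1 hq hμ hΔ hM hdeg hxs hcont k
    have h2 : expectedValue G Δ q μ (smoothObj G Δ q μ) k + (mass Δ * μ ^ q - c) =
        ∫ x, (smoothObj G Δ q μ x + (mass Δ * μ ^ q - c)) ∂(iterateLaw G Δ q μ k).toMeasure := by
      rw [integral_add hi2 (integrable_const _)]
      simp [expectedValue]
    rw [h2]
    refine integral_mono_ae hi1 (hi2.add (integrable_const _)) ?_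
    filter_upwards [ae_mem_support (iterateLaw G Δ q μ k)] with x hx
    have hx' := iterateLaw_support_subset hq1 hq hμ hdeg k hx
    have h3 := dualObj_add_le_smoothObj_add (G := G) (Δ := Δ) hq0 hμ (x := x) (T := supp x)
      fun i => mem_supp.2
    -- Iterates are settled, so the edge count is replaced by the support volume, at most |Δ|.
    have h4 : 1 / q * ((∑ i ∈ supp x, (G.degree i : ℝ)) * μ ^ q) ≤ 1 * (mass Δ * μ ^ q) := by
      refine mul_le_mul ?_ (mul_le_mul_of_nonneg_right (vol_supp_le hΔ hx')
        (Real.rpow_nonneg hμ.le _)) (mul_nonneg (Finset.sum_nonneg fun i _ => by positivity)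
          (Real.rpow_nonneg hμ.le _)) zero_le_one
      rw [div_le_one hq0]
      exact hq1.le
    linarith
  have h5 := smoothObj_le_dualObj_add (G := G) (Δ := Δ) hq0 hq hμ xF
  have h6 := hxs.2 xF hxF
  linarith

end Expectation

/-! ### Elementary estimates for the iteration counts. -/

section Rates

/-- The factor 2 in the iteration count produces ε²: one ε is the target accuracy, the other absorbs
2A. -/
lemma exp_mul_rpow_le {M L γ ε K A : ℝ} (hM : 0 < M) (hL : 0 < L) (hγ : 0 < γ) (hε : 0 < ε)
    (hA : 0 < A) (hεA : ε ≤ 1 / (2 * A)) (hK : 2 * (M * L / γ * Real.log (1 / ε)) ≤ K) :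
    Real.exp (-(γ / (M * L)) * K) * A ≤ ε / 2 := by
  have h1 : 2 * Real.log (1 / ε) ≤ γ / (M * L) * K := by
    calc 2 * Real.log (1 / ε) = γ / (M * L) * (2 * (M * L / γ * Real.log (1 / ε))) := by
          field_simp
      _ ≤ _ := mul_le_mul_of_nonneg_left hK (by positivity)
  have h2 : Real.exp (-(γ / (M * L)) * K) ≤ ε ^ 2 := by
    rw [← Real.exp_log (pow_pos hε 2), Real.exp_le_exp, Real.log_pow]
    rw [one_div, Real.log_inv] at h1
    push_cast
    linarith
  rw [le_div_iff₀ (by positivity)] at hεA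
  calc Real.exp (-(γ / (M * L)) * K) * A ≤ ε ^ 2 * A := mul_le_mul_of_nonneg_right h2 hA.le
    _ = ε * (ε * (2 * A)) / 2 := by ring
    _ ≤ ε * 1 / 2 := by gcongr
    _ = ε / 2 := by ring

/-- Since c ≤ 1 and q - 2 ≥ -1, the factor c^(q-2) is at most 1/c, which frees the constant from q.
-/
lemma rpow_sub_two_le {q c M ε μ : ℝ} (hq1 : 1 < q) (hq : q ≤ 2) (hc : 0 < c) (hc1 : c ≤ 1)
    (hM : 0 < M) (hε : 0 < ε) (hμ : c * (ε / M) ^ (1 / q) ≤ μ) :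
    μ ^ (q - 2) ≤ 1 / c * (M / ε) ^ (2 / q - 1) := by
  have hb : 0 < ε / M := by positivity
  have hpos : 0 < c * (ε / M) ^ (1 / q) := mul_pos hc (Real.rpow_pos_of_pos hb _)
  refine (Real.rpow_le_rpow_of_nonpos hpos hμ (by linarith)).trans ?_
  rw [Real.mul_rpow hc.le (Real.rpow_nonneg hb.le _), ← Real.rpow_mul hb.le]
  refine mul_le_mul ?_ (le_of_eq ?_) (Real.rpow_nonneg hb.le _) (by positivity)
  · rw [one_div, ← Real.rpow_neg_one]
    exact Real.rpow_le_rpow_of_exponent_ge hc hc1 (by linarith)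
  · rw [← inv_div, Real.inv_rpow (by positivity), ← Real.rpow_neg (by positivity)]
    congr 1
    field_simp
    ring

lemma mul_rpow_le_half {q M ε μ : ℝ} (hq1 : 1 < q) (hM : 0 < M) (hε : 0 < ε) (hμ0 : 0 < μ)
    (hμ : μ ≤ 1 / 2 * (ε / M) ^ (1 / q)) : M * μ ^ q ≤ ε / 2 := by
  have hb : 0 < ε / M := by positivity
  have h1 := Real.rpow_le_rpow hμ0.le hμ (by linarith : 0 ≤ q)
  rw [Real.mul_rpow (by norm_num) (Real.rpow_nonneg hb.le _), ← Real.rpow_mul hb.le,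
    one_div_mul_cancel (by linarith), Real.rpow_one] at h1
  have h2 : (1 / 2 : ℝ) ^ q ≤ 1 / 2 := by
    simpa using Real.rpow_le_rpow_of_exponent_ge (by norm_num : (0 : ℝ) < 1 / 2) (by norm_num)
      hq1.le
  calc M * μ ^ q ≤ M * (1 / 2 * (ε / M)) := mul_le_mul_of_nonneg_left
        (h1.trans (mul_le_mul_of_nonneg_right h2 hb.le)) hM.le
    _ = ε / 2 := by field_simp

end Rates

end FlowDiffusion

/-! ### The iteration complexity theorem. -/

open FlowDiffusion in
theorem mainTheorem3 :
    ∃ C c₀ : ℝ, 0 < C ∧ 0 < c₀ ∧ ∀ c : ℝ, 0 < c → c ≤ c₀ → ∃ C' : ℝ, 0 < C' ∧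
      ∀ p q : ℝ, 2 ≤ p → p.HolderConjugate q →
      ∀ M : ℝ, 0 < M → ∃ ε₀ : ℝ, 0 < ε₀ ∧ ε₀ < 1 ∧
      ∀ (V : Type u) [Fintype V] [DecidableEq V] (G : SimpleGraph V) [DecidableRel G.Adj]
        (Δ : V → ℝ), G.Connected → (∀ i, 0 ≤ Δ i) → FlowDiffusion.mass Δ = M →
        FlowDiffusion.mass Δ < FlowDiffusion.vol G →
      ∃ xF : EuclideanSpace ℝ V, FlowDiffusion.IsOptimal (FlowDiffusion.dualObj G Δ q) xF ∧
      ∀ μ : ℝ, 0 < μ →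
      ∃ xs : EuclideanSpace ℝ V,
        FlowDiffusion.IsOptimal (FlowDiffusion.smoothObj G Δ q μ) xs ∧
        (∀ y, FlowDiffusion.IsOptimal (FlowDiffusion.smoothObj G Δ q μ) y → y = xs) ∧
        (μ ≤ 1 → ∃ γ : ℝ, 1 / ((p - 1) * FlowDiffusion.mass Δ ^ p) < γ ∧
          FlowDiffusion.IsStrongConvexityParam (FlowDiffusion.smoothObj G Δ q μ)
            (FlowDiffusion.localSet G Δ p μ xs) γ) ∧
        ∀ γ : ℝ, 0 < γ →
          FlowDiffusion.IsStrongConvexityParam (FlowDiffusion.smoothObj G Δ q μ)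
            (FlowDiffusion.localSet G Δ p μ xs) γ →
          ∀ ε : ℝ, 0 < ε → ε ≤ ε₀ →
            (μ ≤ 1 → ∀ K : ℕ,
              C * (FlowDiffusion.mass Δ * FlowDiffusion.maxLip G q μ xs / γ
                * Real.log (1 / ε)) ≤ K →
              FlowDiffusion.expectedValue G Δ q μ (FlowDiffusion.smoothObj G Δ q μ) K
                - FlowDiffusion.smoothObj G Δ q μ xs ≤ ε) ∧
            (c * (ε / FlowDiffusion.mass Δ) ^ (1 / q) ≤ μ →
              μ ≤ c₀ * (ε / FlowDiffusion.mass Δ) ^ (1 / q) → ∀ K' : ℕ,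
              C' * (FlowDiffusion.mass Δ * FlowDiffusion.maxDeg G xs / γ
                * (FlowDiffusion.mass Δ / ε) ^ (2 / q - 1) * Real.log (1 / ε)) ≤ K' →
              FlowDiffusion.expectedValue G Δ q μ (FlowDiffusion.dualObj G Δ q) K'
                - FlowDiffusion.dualObj G Δ q xF ≤ ε) := by
  -- C = 2 comes from the ε² trick and c₀ = 1/2 makes |Δ|μ^q at most ε/2. In ε₀, the bound 1/2 gives
  -- ε < 1, the bound M forces μ ≤ 1 in the second claim, and the last absorbs the initial gap.
  refine ⟨2, 1 / 2, by norm_num, by norm_num, fun c hc hc0 => ⟨2 / c, by positivity,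
    fun p q hp hpq M hM0 => ⟨min (1 / 2) (min M (1 / (2 * M ^ (p + 1)))), by positivity,
    (min_le_left _ _).trans_lt (by norm_num), ?_⟩⟩⟩
  intro V _ _ G _ Δ hG hΔ hMeq hvol
  have hq1 : 1 < q := hpq.symm.lt
  have hq0 : 0 < q := by linarith
  have hmul : (p - 1) * (q - 1) = 1 := by linarith [hpq.sub_one_mul_conj]
  have hq2 : q ≤ 2 := by nlinarith
  have hdeg : ∀ i, (1 : ℝ) ≤ G.degree i := one_le_degree hG (by linarith)
  obtain ⟨xF, hxF⟩ := exists_isOptimal hG hΔ hvol hpq (continuous_dualObj (G := G) (Δ := Δ) hq0)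
    fun x => le_rfl
  refine ⟨xF, hxF, fun μ hμ => ?_⟩
  obtain ⟨xs, hxs⟩ := exists_isOptimal hG hΔ hvol hpq (continuous_smoothObj G Δ hq0 hμ)
    fun x => dualObj_le_smoothObj hq0 x
  have hxsS := settled_of_isOptimal hq1 hq2 hμ hdeg hxs
  refine ⟨xs, hxs, fun y hy => ?_, fun _ => ?_, fun γ hγ hsc ε hε hε0 => ?_⟩
  · ext i
    exact le_antisymm
      (settled_le_of_isOptimal hG hq1 hq2 hμ hΔ hvol hdeg
        (settled_of_isOptimal hq1 hq2 hμ hdeg hy) hxs i)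
      (settled_le_of_isOptimal hG hq1 hq2 hμ hΔ hvol hdeg hxsS hy i)
  · by_cases h0 : ∀ i, xs i = 0
    -- Here U contains at most the origin, so every number is a strong convexity parameter.
    · refine ⟨1 / ((p - 1) * mass Δ ^ p) + 1, by linarith, fun x hx y hy => ?_⟩
      have hz : ∀ z ∈ localSet G Δ p μ xs, z = 0 := fun z hz => by
        ext i
        by_contra h
        exact hz.1 i h (h0 i)
      rw [hz x hx, hz y hy]
      simp
    · push Not at h0
      obtain ⟨u, hu⟩ := h0
      exact exists_strongConvexityParam hG hq1 hq2 hμ hmul hΔ hvol hdeg hxsS hu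
  · have hmass : 0 < mass Δ := hMeq ▸ hM0
    rw [← hMeq] at hε0
    -- Accuracy ε/2 leaves the other half for the smoothing error in the second claim.
    have key : μ ≤ 1 → ∀ K : ℕ, 2 * (mass Δ * maxLip G q μ xs / γ * Real.log (1 / ε)) ≤ K →
        expectedValue G Δ q μ (smoothObj G Δ q μ) K - smoothObj G Δ q μ xs ≤ ε / 2 := by
      intro hμ1 K hK
      by_cases h0 : ∀ i, xs i = 0
      · rw [expectedValue_of_isOptimal_zero hG hq1 hq2 hμ hΔ hvol hdeg hxs h0]
        linarith
      · push Not at h0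
        obtain ⟨u, hu⟩ := h0
        -- A nonzero minimizer has a support of volume at least 1 and at most |Δ|.
        have h1M : 1 ≤ mass Δ := by
          have h1 := Finset.single_le_sum (f := fun k => (G.degree k : ℝ))
            (fun k _ => by positivity) (mem_supp.2 hu)
          exact (hdeg u).trans (h1.trans (vol_supp_le hΔ hxsS))
        exact (expectedValue_sub_le hG hq1 hq2 hμ hμ1 hmul hΔ hvol hdeg h1M hxs hu hγ hsc K).trans
          (exp_mul_rpow_le hmass ((lip_pos hμ hdeg u).trans_le (lip_le_maxLip xs hu)) hγ hε
            (Real.rpow_pos_of_pos hmass _)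
            (hε0.trans ((min_le_right _ _).trans (min_le_right _ _))) hK)
    refine ⟨fun hμ1 K hK => (key hμ1 K hK).trans (by linarith), fun hlo hhi K' hK' => ?_⟩
    have hμ1 : μ ≤ 1 := by
      have h1 : (ε / mass Δ) ^ (1 / q) ≤ 1 := Real.rpow_le_one (by positivity)
        ((div_le_one hmass).2 (hε0.trans ((min_le_right _ _).trans (min_le_left _ _))))
        (by positivity)
      linarith
    have hlog : 0 ≤ Real.log (1 / ε) := Real.log_nonneg
      ((one_le_div hε).2 (by linarith [hε0.trans (min_le_left _ _)]))
    have hgap : expectedValue G Δ q μ (smoothObj G Δ q μ) K' - smoothObj G Δ q μ xs ≤ ε / 2 := by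
      by_cases h0 : ∀ i, xs i = 0
      · rw [expectedValue_of_isOptimal_zero hG hq1 hq2 hμ hΔ hvol hdeg hxs h0]
        linarith
      · push Not at h0
        obtain ⟨u, hu⟩ := h0
        refine key hμ1 K' (le_trans ?_ hK')
        have hD : 0 ≤ maxDeg G xs :=
          (Nat.cast_nonneg (G.degree u)).trans (le_csSup (Set.toFinite _).bddAbove ⟨u, hu, rfl⟩)
        have h1 : maxLip G q μ xs ≤ maxDeg G xs * (1 / c * (mass Δ / ε) ^ (2 / q - 1)) :=
          (maxLip_le hμ xs hu).trans (mul_le_mul_of_nonneg_left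
            (rpow_sub_two_le hq1 hq2 hc (by linarith) hmass hε hlo) hD)
        calc 2 * (mass Δ * maxLip G q μ xs / γ * Real.log (1 / ε))
            ≤ 2 * (mass Δ * (maxDeg G xs * (1 / c * (mass Δ / ε) ^ (2 / q - 1))) / γ
              * Real.log (1 / ε)) := by gcongr
          _ = _ := by field_simp
    have h1 := expectedValue_dualObj_sub_le hG hq1 hq2 hμ hΔ hvol hdeg hxs hxF.1 K'
    have h2 := mul_rpow_le_half hq1 hmass hε hμ hhi
    linarith
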